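/- Let $n\ge 1$, $s\in\mathbb{R}$, $\mu_s(x)=(1+|x|^2)^{s/2}$, $\mathbb{T}^n=[-\tfrac12,\tfrac12)^n$, and let $H^s=H^s(\mathbb{R}^n)$ be the Sobolev space of tempered distributions $f$ with $\widehat f\mu_s\in L^2(\mathbb{R}^n)$ (where $\widehat f(t)=\int f(x)e^{-2\pi i\langle x,t\rangle}\,dx$ for integrable $f$), with inner product $\langle f,g\rangle_{H^s}=\int \widehat f\,\overline{\widehat g}\,\mu_s^2\,dt$. Let $T_kf=f(\cdot-k)$ for $k\in\mathbb{Z}^n$. Let $\ell^2_s$ be the Hilbert space of sequences $(c_k)_{k\in\mathbb{Z}^n}$ with $(c_k\mu_s(k))_k\in\ell^2$, with inner product $\langle c,d\rangle=\sum_k c_k\overline{d_k}\mu_s(k)^2$, and for $f\in H^s$ put $$\mathcal{T}_sf(t)=\Big(\frac{\widehat f(t+k)\,\mu_s(t+k)}{\mu_s(k)}\Big)_{k\in\mathbb{Z}^n}\in\ell^2_s\qquad\text{for a.e. }t\in\mathbb{T}^n .$$ Let $I$ be a countable index set and $\varphi_i\in H^s$ $(i\in I)$. Put $E(\varphi)=\{T_k\varphi_i:k\in\mathbb{Z}^n,\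 i\in I\}$, a family indexed by $\mathbb{Z}^n\times I$, let $S$ be its closed linear span in $H^s$, and let $J(t)=\overline{\operatorname{span}}\{\mathcal{T}_s\varphi_i(t):i\in I\}\subset\ell_s^2$. Let $0<A\le B$. A family $(e_j)$ in $S$ is a frame for $S$ with bounds $A,B$ if $A\|f\|^2\le\sum_j|\langle f,e_j\rangle|^2\le B\|f\|^2$ for all $f\in S$; a family $(e_j)$ is a Riesz family with bounds $A,B$ if $A\sum_j|c_j|^2\le\|\sum_jc_je_j\|^2\le B\sum_j|c_j|^2$ for all finitely supported $(c_j)$. A bounded operator $L:S\to H^s$ is shift-preserving if $LT_k=T_kL$ for all $k\in\mathbb{Z}^n$. A range operator on $J$ assigns to each $t$ a bounded operator $R(t):J(t)\to\ell^2_s$; it corresponds to $L:S\to H^s$ if for every $f\in S$, for a.e. $t\in\mathbb{T}^n$, $\mathcal{T}_sf(t)\in J(t)$ and $\mathcal{T}_s(Lf)(t)=R(t)(\mathcal{T}_sf(t))$. It is measurable if $t\mapsto\langle R(t)P_{J(t)}a,b\rangle$ is measurable on $\mathbb{T}^n$ for all $a,b\in\ell^2_s$, where $P_{J(t)}$ is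 the orthogonal projection onto $J(t)$. **Theorem.** Suppose that $E(\varphi)$ is a frame for $S$ with bounds $A,B$, or a Riesz family with bounds $A,B$. Then the frame operator $$Ff=\sum_{(k,i)\in\mathbb{Z}^n\times I}\langle f,T_k\varphi_i\rangle_{H^s}T_k\varphi_i,\qquad f\in S,$$ converges unconditionally in $H^s$ and defines a bounded bijection $F:S\to S$ with bounded inverse; $F$ and $F^{-1}$ are shift-preserving. Put $\theta_i=F^{-1}\varphi_i$ for $i\in I$. Then: 1. $T_k\theta_i=F^{-1}T_k\varphi_i$ for all $k,i$, the closed span of $E(\theta)=\{T_k\theta_i\}$ is $S$, and $E(\theta)$ is a frame for $S$ with bounds $B^{-1},A^{-1}$ which is dual to $E(\varphi)$: for all $f\in S$, $$f=\sum_{(k,i)}\langle f,T_k\theta_i\rangle_{H^s}T_k\varphi_i=\sum_{(k,i)}\langle f,T_k\varphi_i\rangle_{H^s}T_k\theta_i$$ with unconditional convergence. 2. If $E(\varphi)$ is a Riesz family with bounds $A,B$, then $E(\theta)$ is the dual Riesz family, with bounds $B^{-1},A^{-1}$: it is a Riesz family with these bounds, and $\langle T_k\varphi_i,T_l\theta_j\rangle_{H^s}=\delta_{k,l}\delta_{i,j}$.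 3. There is a measurable range operator on $J$ corresponding to $F$. For every range operator $R$ on $J$ that corresponds to $F$, for a.e. $t\in\mathbb{T}^n$ the operator $R(t)$ is a bijection of $J(t)$ onto $J(t)$ with bounded inverse, and $\mathcal{T}_s\theta_i(t)=R(t)^{-1}\big(\mathcal{T}_s\varphi_i(t)\big)$ for all $i\in I$. -/

import Mathlib

open MeasureTheory FourierTransform TemperedDistribution
open scoped ENNReal SchwartzMap ComplexConjugate

noncomputable section

namespace SobolevSI

/-- The Euclidean space `ℝⁿ`. -/
abbrev Rn (n : ℕ) : Type := EuclideanSpace ℝ (Fin n)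

/-- The lattice `ℤⁿ`. -/
abbrev Zn (n : ℕ) : Type := Fin n → ℤ

/-- The inclusion of `ℤⁿ` in `ℝⁿ`. -/
def latticePt {n : ℕ} (k : Zn n) : Rn n := WithLp.toLp 2 (fun j => (k j : ℝ))

/-- The cube `𝕋ⁿ = [-1/2, 1/2)ⁿ`. -/
def cube (n : ℕ) : Set (Rn n) := {t | ∀ j, t j ∈ Set.Ico (-(1 / 2) : ℝ) (1 / 2)}

/-- The weight `μ_s(x) = (1 + |x|²)^{s/2}`. -/
def weight {n : ℕ} (s : ℝ) (x : Rn n) : ℝ := (1 + ‖x‖ ^ 2) ^ (s / 2)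

theorem weight_pos {n : ℕ} (s : ℝ) (x : Rn n) : 0 < weight s x := by
  unfold weight; positivity

/-! ### The Sobolev space `Hˢ` -/

/-- The Sobolev space `Hˢ(ℝⁿ)`, as a space of tempered distributions. -/
def sobolevSubmodule (n : ℕ) (s : ℝ) : Submodule ℂ 𝓢'(Rn n, ℂ) where
  carrier := {f | MemSobolev s 2 f}
  add_mem' hf hg := MemSobolev.add hf hg
  zero_mem' := memSobolev_fun_zero (Rn n) ℂ s 2
  smul_mem' c _ hf := MemSobolev.smul c hf

/-- The Sobolev space `Hˢ(ℝⁿ)` as a type of its own; it carries the Sobolev norm, not the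
topology of the space of tempered distributions. -/
def Hs (n : ℕ) (s : ℝ) : Type := sobolevSubmodule n s

instance (n : ℕ) (s : ℝ) : AddCommGroup (Hs n s) :=
  inferInstanceAs (AddCommGroup (sobolevSubmodule n s))

instance (n : ℕ) (s : ℝ) : Module ℂ (Hs n s) :=
  inferInstanceAs (Module ℂ (sobolevSubmodule n s))

/-- The tempered distribution underlying an element of `Hˢ`. -/
def Hs.toDistr {n : ℕ} {s : ℝ} : Hs n s →ₗ[ℂ] 𝓢'(Rn n, ℂ) := (sobolevSubmodule n s).subtype

theorem Hs.exists_weightedFourier {n : ℕ} {s : ℝ} (f : Hs n s) :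
    ∃ h : Lp ℂ 2 (volume : Measure (Rn n)),
      smulLeftCLM ℂ (fun x : Rn n => ((weight s x : ℝ) : ℂ)) (𝓕 f.toDistr) =
        Lp.toTemperedDistributionCLM ℂ volume 2 h :=
  memSobolev_iff_exists_smulLeftCLM_fourier.mp f.2

theorem toDistr_Lp_injective {n : ℕ} :
    Function.Injective (Lp.toTemperedDistributionCLM ℂ (volume : Measure (Rn n)) 2) :=
  LinearMap.ker_eq_bot.mp Lp.ker_toTemperedDistributionCLM_eq_bot

/-- The function `x ↦ μ_s(x) f̂(x)` in `L²(ℝⁿ)`, for `f ∈ Hˢ`. -/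
def Hs.weightedFourier {n : ℕ} {s : ℝ} : Hs n s →ₗ[ℂ] Lp ℂ 2 (volume : Measure (Rn n)) where
  toFun f := f.exists_weightedFourier.choose
  map_add' f g := by
    apply toDistr_Lp_injective
    refine (f + g).exists_weightedFourier.choose_spec.symm.trans ?_
    rw [map_add, FourierTransform.fourier_add, map_add, map_add]
    exact congrArg₂ (· + ·) f.exists_weightedFourier.choose_spec
      g.exists_weightedFourier.choose_spec
  map_smul' c f := by
    apply toDistr_Lp_injective
    refine (c • f).exists_weightedFourier.choose_spec.symm.trans ?_
    rw [RingHom.id_apply, map_smul, FourierTransform.fourier_smul, map_smul, map_smul]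
    exact congrArg (c • ·) f.exists_weightedFourier.choose_spec

theorem Hs.weightedFourier_spec {n : ℕ} {s : ℝ} (f : Hs n s) :
    smulLeftCLM ℂ (fun x : Rn n => ((weight s x : ℝ) : ℂ)) (𝓕 f.toDistr) =
      Lp.toTemperedDistributionCLM ℂ volume 2 f.weightedFourier :=
  f.exists_weightedFourier.choose_spec

theorem Hs.weightedFourier_injective {n : ℕ} {s : ℝ} :
    Function.Injective (Hs.weightedFourier : Hs n s →ₗ[ℂ] _) := by
  rw [injective_iff_map_eq_zero]
  intro f hf
  have h := f.weightedFourier_spec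
  rw [hf, map_zero] at h
  have h2 : besselPotential (Rn n) ℂ s f.toDistr = 0 := by
    have h3 : 𝓕 (besselPotential (Rn n) ℂ s f.toDistr) = 0 := by
      rw [fourier_besselPotential_eq_smulLeftCLM_fourier_apply]; exact h
    have h4 : 𝓕⁻ (𝓕 (besselPotential (Rn n) ℂ s f.toDistr)) = 𝓕⁻ (0 : 𝓢'(Rn n, ℂ)) :=
      congrArg (fun u => 𝓕⁻ u) h3
    rw [fourierInv_fourier_eq] at h4
    rw [h4]
    exact (fourierInvCLM ℂ 𝓢'(Rn n, ℂ)).map_zero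
  have h5 : f.toDistr = 0 := by
    have := besselPotential_besselPotential_apply s (-s) f.toDistr
    rw [h2] at this
    simpa using this.symm
  exact Subtype.ext h5

instance (n : ℕ) (s : ℝ) : NormedAddCommGroup (Hs n s) :=
  NormedAddCommGroup.induced (Hs n s) (Lp ℂ 2 (volume : Measure (Rn n))) Hs.weightedFourier
    Hs.weightedFourier_injective

/-- The inner product is `⟨f, g⟩ = ∫ f̂ ḡ̂ μ_s²`, conjugate linear in the *first* slot of Mathlib's
`inner`, so that `inner ℂ g f` is `⟨f, g⟩`. -/
instance (n : ℕ) (s : ℝ) : InnerProductSpace ℂ (Hs n s) :=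
  InnerProductSpace.induced (Hs.weightedFourier : Hs n s →ₗ[ℂ] _)

/-! ### Translations -/

/-- Translation `T_a f = f(· - a)` of a tempered distribution: `(T_a f)(ψ) = f(ψ(· + a))`. -/
def translate {n : ℕ} (a : Rn n) : 𝓢'(Rn n, ℂ) →L[ℂ] 𝓢'(Rn n, ℂ) :=
  PointwiseConvergenceCLM.precomp ℂ (SchwartzMap.compSubConstCLM ℂ (-a))

/-- The character `x ↦ e^{-2πi⟨a, x⟩}`. -/
def phase {n : ℕ} (a : Rn n) (x : Rn n) : ℂ :=
  Complex.exp (((-2 * Real.pi * inner ℝ x a : ℝ) : ℂ) * Complex.I)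

theorem phase_hasTemperateGrowth {n : ℕ} (a : Rn n) : (phase a).HasTemperateGrowth := by
  have h1 : (fun u : ℝ => Complex.exp ((u : ℂ) * Complex.I)).HasTemperateGrowth := by
    have hd : ∀ m : ℕ, iteratedDeriv m (fun u : ℝ => Complex.exp ((u : ℂ) * Complex.I)) =
        fun u : ℝ => Complex.I ^ m * Complex.exp ((u : ℂ) * Complex.I) := by
      intro m
      induction m with
      | zero => simp
      | succ m ih =>
        rw [iteratedDeriv_succ, ih]
        funext u
        have h : HasDerivAt (fun u : ℝ => Complex.I ^ m * Complex.exp ((u : ℂ) * Complex.I))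
            (Complex.I ^ m * (Complex.exp ((u : ℂ) * Complex.I) * (1 * Complex.I))) u :=
          (((hasDerivAt_id u).ofReal_comp.mul_const Complex.I).cexp).const_mul _
        rw [h.deriv]
        ring
    refine ⟨(Complex.ofRealCLM.contDiff.mul contDiff_const).cexp, fun m => ⟨0, 1, fun u => ?_⟩⟩
    rw [norm_iteratedFDeriv_eq_norm_iteratedDeriv, hd]
    simp [Complex.norm_exp_ofReal_mul_I]
  have h2 : (fun x : Rn n => -2 * Real.pi * inner ℝ x a).HasTemperateGrowth := by
    fun_prop
  exact h1.comp h2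

theorem norm_phase {n : ℕ} (a x : Rn n) : ‖phase a x‖ = 1 := by
  rw [phase, Complex.norm_exp_ofReal_mul_I]

theorem fourier_translate {n : ℕ} (a : Rn n) (f : 𝓢'(Rn n, ℂ)) :
    𝓕 (translate a f) = smulLeftCLM ℂ (phase a) (𝓕 f) := by
  ext ψ
  rw [smulLeftCLM_apply_apply, TemperedDistribution.fourier_apply,
    TemperedDistribution.fourier_apply]
  change f ((𝓕 ψ).compSubConstCLM ℂ (-a)) = _
  congr 1
  ext x
  rw [SchwartzMap.compSubConstCLM_apply, SchwartzMap.fourier_coe, SchwartzMap.fourier_coe,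
    Real.fourier_eq', Real.fourier_eq']
  congr 1
  funext v
  rw [SchwartzMap.smulLeftCLM_apply_apply (phase_hasTemperateGrowth a), phase, smul_eq_mul,
    smul_eq_mul, smul_eq_mul, ← mul_assoc, ← Complex.exp_add]
  congr 2
  rw [sub_neg_eq_add, inner_add_right]
  push_cast
  ring

theorem memSobolev_translate {n : ℕ} {s : ℝ} (a : Rn n) {f : 𝓢'(Rn n, ℂ)}
    (hf : MemSobolev s 2 f) : MemSobolev s 2 (translate a f) := by
  have h : translate a f = fourierMultiplierCLM ℂ (phase a) f := by
    rw [fourierMultiplierCLM_apply, ← fourier_translate, fourierInv_fourier_eq]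
  rw [h]
  exact hf.fourierMultiplierCLM_of_bounded (phase_hasTemperateGrowth a)
    ⟨1, fun x => (norm_phase a x).le⟩

/-- The integer shift `T_k` on `Hˢ`. -/
def shift {n : ℕ} {s : ℝ} (k : Zn n) (f : Hs n s) : Hs n s :=
  ⟨translate (latticePt k) f.toDistr, memSobolev_translate _ f.2⟩

theorem shift_zero {n : ℕ} {s : ℝ} (f : Hs n s) : shift 0 f = f := by
  apply Subtype.ext
  have h : latticePt (0 : Zn n) = 0 := by
    ext j; simp [latticePt]
  change translate (latticePt (0 : Zn n)) f.toDistr = f.toDistr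
  rw [h]
  ext ψ
  change f.toDistr (ψ.compSubConstCLM ℂ (-0)) = f.toDistr ψ
  simp

/-- `V` is shift-invariant: `f ∈ V` implies `T_k f ∈ V` for all `k ∈ ℤⁿ`. -/
def IsShiftInvariant {n : ℕ} {s : ℝ} (V : Submodule ℂ (Hs n s)) : Prop :=
  ∀ (k : Zn n), ∀ f ∈ V, shift k f ∈ V

/-- A bounded operator `L : V → Hˢ` on a shift-invariant space is shift-preserving if
`L T_k = T_k L` for all `k ∈ ℤⁿ`. -/
def IsShiftPreserving {n : ℕ} {s : ℝ} (V : Submodule ℂ (Hs n s)) (L : V →L[ℂ] Hs n s) : Prop :=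
  ∃ hV : IsShiftInvariant V, ∀ (k : Zn n) (f : V), L ⟨shift k f, hV k f f.2⟩ = shift k (L f)

/-- The family `E_s = {T_k φ_i : k ∈ ℤⁿ, i ∈ I}`. -/
def shifts {n : ℕ} {s : ℝ} {I : Type*} (φ : I → Hs n s) (p : Zn n × I) : Hs n s :=
  shift p.1 (φ p.2)

/-- The shift-invariant space `S_s` generated by the `φ_i`: the closed span of their shifts. -/
def shiftSpan {n : ℕ} {s : ℝ} {I : Type*} (φ : I → Hs n s) : Submodule ℂ (Hs n s) :=
  (Submodule.span ℂ (Set.range (shifts φ))).topologicalClosure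

theorem mem_shiftSpan {n : ℕ} {s : ℝ} {I : Type*} (φ : I → Hs n s) (i : I) :
    φ i ∈ shiftSpan φ :=
  Submodule.le_topologicalClosure _ (Submodule.subset_span ⟨(0, i), shift_zero (φ i)⟩)

/-! ### Frames and Riesz families -/

section Frames

variable {H : Type*} [NormedAddCommGroup H] [InnerProductSpace ℂ H] {ι : Type*}

/-- `(e_j)` is a frame for the subspace `V` with bounds `A`, `B`. -/
structure IsFrame (A B : ℝ) (V : Submodule ℂ H) (e : ι → H) : Prop where
  pos : 0 < A
  le : A ≤ B
  mem : ∀ j, e j ∈ V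
  summable : ∀ f ∈ V, Summable fun j => ‖inner ℂ (e j) f‖ ^ 2
  lower : ∀ f ∈ V, A * ‖f‖ ^ 2 ≤ ∑' j, ‖inner ℂ (e j) f‖ ^ 2
  upper : ∀ f ∈ V, ∑' j, ‖inner ℂ (e j) f‖ ^ 2 ≤ B * ‖f‖ ^ 2

/-- `(e_j)` is a Riesz family (a Riesz basis of its closed span) with bounds `A`, `B`. -/
structure IsRieszFamily (A B : ℝ) (e : ι → H) : Prop where
  pos : 0 < A
  le : A ≤ B
  lower : ∀ c : ι →₀ ℂ, A * ∑ j ∈ c.support, ‖c j‖ ^ 2 ≤ ‖∑ j ∈ c.support, c j • e j‖ ^ 2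
  upper : ∀ c : ι →₀ ℂ, ‖∑ j ∈ c.support, c j • e j‖ ^ 2 ≤ B * ∑ j ∈ c.support, ‖c j‖ ^ 2

/-- `(g_j)` is dual to `(e_j)` on `V`: for every `f ∈ V`,
`f = ∑ ⟨f, g_j⟩ e_j = ∑ ⟨f, e_j⟩ g_j`, with unconditional convergence. -/
def IsDualOn (V : Submodule ℂ H) (e g : ι → H) : Prop :=
  ∀ f ∈ V, HasSum (fun j => inner ℂ (g j) f • e j) f ∧ HasSum (fun j => inner ℂ (e j) f • g j) f

/-- `⟨e_i, g_j⟩ = δ_{ij}`. -/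
def IsBiorthogonal (e g : ι → H) : Prop :=
  (∀ j, inner ℂ (g j) (e j) = 1) ∧ ∀ i j, i ≠ j → inner ℂ (g j) (e i) = 0

/-- `F` is the frame operator of `(e_j)` on `V`: `F f = ∑ ⟨f, e_j⟩ e_j` for `f ∈ V`, with
unconditional convergence. -/
def IsFrameOperator (V : Submodule ℂ H) (e : ι → H) (F : V →L[ℂ] V) : Prop :=
  ∀ f : V, HasSum (fun j => inner ℂ (e j) (f : H) • e j) (F f : H)

end Frames

/-! ### The weighted sequence space `ℓ²_s` -/

/-- The space of sequences `c : ℤⁿ → ℂ` such that `c μ_s ∈ ℓ²`. -/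
def weightedSubmodule (n : ℕ) (s : ℝ) : Submodule ℂ (Zn n → ℂ) where
  carrier := {c | Memℓp (fun k => (weight s (latticePt k) : ℂ) * c k) 2}
  add_mem' {c d} hc hd := by
    have h := Memℓp.add hc hd
    have h' : (fun k => (weight s (latticePt k) : ℂ) * (c + d) k) =
        (fun k => (weight s (latticePt k) : ℂ) * c k) +
          fun k => (weight s (latticePt k) : ℂ) * d k := by
      funext k; simp [mul_add]
    change Memℓp (fun k => (weight s (latticePt k) : ℂ) * (c + d) k) 2
    rw [h']; exact h
  zero_mem' := by
    change Memℓp (fun k => (weight s (latticePt k) : ℂ) * (0 : Zn n → ℂ) k) 2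
    have h : (fun k => (weight s (latticePt k) : ℂ) * (0 : Zn n → ℂ) k) = 0 := by
      funext k; simp
    rw [h]; exact zero_memℓp
  smul_mem' a c hc := by
    have h := Memℓp.const_smul hc a
    have h' : (fun k => (weight s (latticePt k) : ℂ) * (a • c) k) =
        a • fun k => (weight s (latticePt k) : ℂ) * c k := by
      funext k; simp [mul_left_comm]
    change Memℓp (fun k => (weight s (latticePt k) : ℂ) * (a • c) k) 2
    rw [h']; exact h

/-- The weighted sequence space `ℓ²_s(ℤⁿ)`. -/
def Ell2 (n : ℕ) (s : ℝ) : Type := weightedSubmodule n s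

instance (n : ℕ) (s : ℝ) : AddCommGroup (Ell2 n s) :=
  inferInstanceAs (AddCommGroup (weightedSubmodule n s))

instance (n : ℕ) (s : ℝ) : Module ℂ (Ell2 n s) :=
  inferInstanceAs (Module ℂ (weightedSubmodule n s))

/-- Multiplication by the weight, `c ↦ c μ_s`, from `ℓ²_s` onto `ℓ²`. -/
def Ell2.mulWeight (n : ℕ) (s : ℝ) : Ell2 n s ≃ₗ[ℂ] lp (fun _ : Zn n => ℂ) 2 where
  toFun c := ⟨fun k => (weight s (latticePt k) : ℂ) * c.1 k, c.2⟩
  map_add' c d := Subtype.ext (funext fun k => mul_add _ (c.1 k) (d.1 k))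
  map_smul' a c := Subtype.ext (funext fun k => mul_left_comm _ a (c.1 k))
  invFun d := ⟨fun k => d k / (weight s (latticePt k) : ℂ), by
    have h : (fun k => (weight s (latticePt k) : ℂ) * (d k / (weight s (latticePt k) : ℂ))) =
        fun k => d k := by
      funext k
      have := Complex.ofReal_ne_zero.mpr (weight_pos s (latticePt k)).ne'
      field_simp
    change Memℓp _ 2
    rw [h]; exact d.2⟩
  left_inv c := Subtype.ext (funext fun k => by
    have := Complex.ofReal_ne_zero.mpr (weight_pos s (latticePt k)).ne'
    change (weight s (latticePt k) : ℂ) * c.1 k / (weight s (latticePt k) : ℂ) = c.1 k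
    field_simp)
  right_inv d := Subtype.ext (funext fun k => by
    have := Complex.ofReal_ne_zero.mpr (weight_pos s (latticePt k)).ne'
    change (weight s (latticePt k) : ℂ) * (d k / (weight s (latticePt k) : ℂ)) = d k
    field_simp)

instance (n : ℕ) (s : ℝ) : NormedAddCommGroup (Ell2 n s) :=
  NormedAddCommGroup.induced (Ell2 n s) (lp (fun _ : Zn n => ℂ) 2) (Ell2.mulWeight n s)
    (Ell2.mulWeight n s).injective

/-- The inner product is `⟨c, d⟩ = ∑ c_k d̄_k μ_s(k)²`, written `inner ℂ d c`. -/
instance (n : ℕ) (s : ℝ) : InnerProductSpace ℂ (Ell2 n s) :=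
  InnerProductSpace.induced (Ell2.mulWeight n s).toLinearMap

theorem Ell2.isometry_mulWeight (n : ℕ) (s : ℝ) : Isometry (Ell2.mulWeight n s) :=
  AddMonoidHomClass.isometry_of_norm _ fun _ => rfl

instance (n : ℕ) (s : ℝ) : CompleteSpace (Ell2 n s) :=
  ((IsometryEquiv.mk (Ell2.mulWeight n s).toEquiv
    (Ell2.isometry_mulWeight n s)).completeSpace_iff).mpr inferInstance

/-! ### Fibers, range functions and range operators -/

open Classical in
/-- The fiber `𝒯_s f (t) = (ĝ(t + k) / μ_s(k))_k ∈ ℓ²_s`, where `ĝ = μ_s f̂ ∈ L²(ℝⁿ)`. The sequence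
is in `ℓ²_s` for a.e. `t ∈ 𝕋ⁿ`; the value is `0` at the exceptional points. -/
def fiber {n : ℕ} {s : ℝ} (f : Hs n s) (t : Rn n) : Ell2 n s :=
  if h : (fun k : Zn n => f.weightedFourier (t + latticePt k) / (weight s (latticePt k) : ℂ)) ∈
      weightedSubmodule n s then ⟨_, h⟩ else 0

/-- The range function `J_s(t)` of `shiftSpan φ`: the closed span of the `𝒯_s φ_i (t)`. -/
def rangeFunction {n : ℕ} {s : ℝ} {I : Type*} (φ : I → Hs n s) (t : Rn n) :
    Submodule ℂ (Ell2 n s) :=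
  (Submodule.span ℂ (Set.range fun i => fiber (φ i) t)).topologicalClosure

instance {n : ℕ} {s : ℝ} {I : Type*} (φ : I → Hs n s) (t : Rn n) :
    CompleteSpace (rangeFunction φ t) :=
  inferInstanceAs (CompleteSpace (Submodule.topologicalClosure _))

theorem fiber_mem_rangeFunction {n : ℕ} {s : ℝ} {I : Type*} (φ : I → Hs n s) (i : I)
    (t : Rn n) : fiber (φ i) t ∈ rangeFunction φ t :=
  Submodule.le_topologicalClosure _ (Submodule.subset_span ⟨i, rfl⟩)

/-- A range operator on a range function `J`: for each `t`, a bounded operator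
`R(t) : J(t) → ℓ²_s`. -/
abbrev RangeOperator {n : ℕ} {s : ℝ} (J : Rn n → Submodule ℂ (Ell2 n s)) : Type :=
  (t : Rn n) → J t →L[ℂ] Ell2 n s

/-- `R` is measurable: `t ↦ ⟨R(t) P_{J(t)} a, b⟩` is (Lebesgue) measurable on `𝕋ⁿ` for all
`a, b ∈ ℓ²_s`, where `P_{J(t)}` is the orthogonal projection onto `J(t)`. -/
def RangeOperator.IsMeasurable {n : ℕ} {s : ℝ} {J : Rn n → Submodule ℂ (Ell2 n s)}
    [∀ t, (J t).HasOrthogonalProjection] (R : RangeOperator J) : Prop :=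
  ∀ a b : Ell2 n s,
    AEMeasurable (fun t => inner ℂ b (R t ((J t).orthogonalProjectionOnto a)))
      (volume.restrict (cube n))

/-- `R` is the range operator corresponding to `L : V → Hˢ`: for every `f ∈ V`,
`𝒯_s (L f)(t) = R(t) (𝒯_s f (t))` for a.e. `t ∈ 𝕋ⁿ`. -/
def RangeOperator.Represents {n : ℕ} {s : ℝ} {J : Rn n → Submodule ℂ (Ell2 n s)}
    (R : RangeOperator J) {V : Submodule ℂ (Hs n s)} (L : V →L[ℂ] Hs n s) : Prop :=
  ∀ f : V, ∀ᵐ t ∂(volume.restrict (cube n)),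
    ∃ hf : fiber (f : Hs n s) t ∈ J t, fiber (L f) t = R t ⟨fiber (f : Hs n s) t, hf⟩

end SobolevSI

end

open SobolevSI

/-! A frame operator is symmetric and, by the lower frame bound, bounded below, hence invertible.
The images of the frame under the inverse form the canonical dual frame, whose own frame operator is
that inverse. A Riesz family is a frame for its closed span in which coefficients are unique, and
this uniqueness gives biorthogonality. The `T_k` are isometries that permute the family of shifts,
so `F` and `F⁻¹` commute with them and the canonical dual is again a family of shifts, generated by
the `θ_i = F⁻¹ φ_i`.

For the range operator, the weighted Fourier transform identifies `Hˢ` with `L²(ℝⁿ)`, and tiling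
`ℝⁿ` by lattice translates of the cube turns the fiber map into an isometry into `L²` of the cube
with values in `ℓ²_s`. There `T_k` is multiplication by a scalar exponential. The exponentials form
a Hilbert basis of `L²` of the cube, so a series of shifts of `ψ` has fiber `u(t)` times the fiber
of `ψ`, where `u` has the given Fourier coefficients (`fiber_eq_of_hasSum`). Indicator functions `u`
show that the generators have Bessel fibers with the same bound (`IsBessel.ae_fiber`). Expanding
fiberwise inner products in exponentials shows that the frame operator acts on fibers as the frame
operator of the fibers (`IsBessel.ae_hasSum_fiber`).

This applies both to `φ` with `F` and to `θ` with `F⁻¹`. Almost everywhere the two fiberwise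
operators therefore undo each other on the countably many fibers of the `φ_i`, and by continuity on
all of `J(t)`. No lower frame bound on the fibers is needed. -/

namespace SobolevSI

/-! ### Bessel families and frame operators in Hilbert spaces -/

section AbstractFrames

variable {H : Type*} [NormedAddCommGroup H] [InnerProductSpace ℂ H] {ι : Type*}

/-- `(e_j)` is a Bessel family with bound `B`, stated through the synthesis operator. -/
def IsBessel (B : ℝ) (e : ι → H) : Prop :=
  ∀ (s : Finset ι) (c : ι → ℂ), ‖∑ j ∈ s, c j • e j‖ ^ 2 ≤ B * ∑ j ∈ s, ‖c j‖ ^ 2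

theorem norm_sum_mul_sq_le (s : Finset ι) (c d : ι → ℂ) :
    ‖∑ j ∈ s, c j * d j‖ ^ 2 ≤ (∑ j ∈ s, ‖c j‖ ^ 2) * ∑ j ∈ s, ‖d j‖ ^ 2 := by
  refine le_trans ?_ (Finset.sum_mul_sq_le_sq_mul_sq s (fun j => ‖c j‖) (fun j => ‖d j‖))
  gcongr
  exact (norm_sum_le _ _).trans_eq (Finset.sum_congr rfl fun j _ => norm_mul _ _)

theorem norm_inner_self_eq (f : H) : ‖inner ℂ f f‖ = ‖f‖ ^ 2 := by
  rw [inner_self_eq_norm_sq_to_K]; simp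

theorem norm_inner_sum_smul_sq_le (e : ι → H) (s : Finset ι) (c : ι → ℂ) (f : H) :
    ‖inner ℂ (∑ j ∈ s, c j • e j) f‖ ^ 2 ≤
      (∑ j ∈ s, ‖c j‖ ^ 2) * ∑ j ∈ s, ‖inner ℂ (e j) f‖ ^ 2 := by
  have h := norm_sum_mul_sq_le s (fun j => conj (c j)) (fun j => inner ℂ (e j) f)
  simp only [RCLike.norm_conj] at h
  simpa only [sum_inner, inner_smul_left] using h

/-- Testing the synthesized vector `g` against itself gives `‖g‖⁴ ≤ (∑ |c_j|²) B ‖g‖²` by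
Cauchy-Schwarz; divide by `‖g‖²`. -/
theorem IsBessel.of_sum_inner_le {B : ℝ} (hB : 0 ≤ B) {e : ι → H}
    (h : ∀ (f : H) (s : Finset ι), ∑ j ∈ s, ‖inner ℂ (e j) f‖ ^ 2 ≤ B * ‖f‖ ^ 2) :
    IsBessel B e := by
  intro s c
  have h2 := (norm_inner_sum_smul_sq_le e s c (∑ j ∈ s, c j • e j)).trans
    (mul_le_mul_of_nonneg_left (h _ s) (by positivity))
  rw [norm_inner_self_eq] at h2
  set g := ∑ j ∈ s, c j • e j
  rcases (sq_nonneg ‖g‖).eq_or_lt with h0 | h0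
  · rw [← h0]; positivity
  · nlinarith

theorem inner_sum_inner_smul_left (e : ι → H) (s : Finset ι) (f : H) :
    inner ℂ (∑ j ∈ s, inner ℂ (e j) f • e j) f = ((∑ j ∈ s, ‖inner ℂ (e j) f‖ ^ 2 : ℝ) : ℂ) := by
  rw [sum_inner]
  push_cast
  refine Finset.sum_congr rfl fun j _ => ?_
  rw [inner_smul_left, ← Complex.normSq_eq_conj_mul_self, Complex.normSq_eq_norm_sq]
  norm_cast

/-- Synthesis with the coefficients `⟨f, e_j⟩` themselves: the sum `q` satisfies `q² ≤ B q ‖f‖²`;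
divide by `q`. -/
theorem IsBessel.sum_inner_le {B : ℝ} (hB : 0 ≤ B) {e : ι → H} (h : IsBessel B e) (f : H) (s : Finset ι) :
    ∑ j ∈ s, ‖inner ℂ (e j) f‖ ^ 2 ≤ B * ‖f‖ ^ 2 := by
  have h1 := h s (fun j => inner ℂ (e j) f)
  have h2 : ∑ j ∈ s, ‖inner ℂ (e j) f‖ ^ 2 ≤ ‖∑ j ∈ s, inner ℂ (e j) f • e j‖ * ‖f‖ := by
    refine le_trans ?_ (norm_inner_le_norm (𝕜 := ℂ) (∑ j ∈ s, inner ℂ (e j) f • e j) f)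
    rw [inner_sum_inner_smul_left, Complex.norm_real]
    exact le_abs_self _
  have h0 : 0 ≤ ∑ j ∈ s, ‖inner ℂ (e j) f‖ ^ 2 := by positivity
  set q := ∑ j ∈ s, ‖inner ℂ (e j) f‖ ^ 2
  rcases h0.eq_or_lt with h0 | h0
  · rw [← h0]; positivity
  · have h3 : q ^ 2 ≤ (‖∑ j ∈ s, inner ℂ (e j) f • e j‖ * ‖f‖) ^ 2 := by gcongr
    rw [mul_pow] at h3
    have h4 : q ^ 2 ≤ B * q * ‖f‖ ^ 2 := h3.trans (by gcongr)
    nlinarith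

theorem IsBessel.summable_inner {B : ℝ} (hB : 0 ≤ B) {e : ι → H} (h : IsBessel B e) (f : H) :
    Summable fun j => ‖inner ℂ (e j) f‖ ^ 2 :=
  summable_of_sum_le (fun _ => by positivity) (h.sum_inner_le hB f)

theorem IsBessel.tsum_inner_le {B : ℝ} (hB : 0 ≤ B) {e : ι → H} (h : IsBessel B e) (f : H) :
    ∑' j, ‖inner ℂ (e j) f‖ ^ 2 ≤ B * ‖f‖ ^ 2 :=
  (h.summable_inner hB f).tsum_le_of_sum_le (h.sum_inner_le hB f)

theorem IsBessel.summable_smul [CompleteSpace H] {B : ℝ} (hB : 0 ≤ B) {e : ι → H}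
    (h : IsBessel B e) {c : ι → ℂ} (hc : Summable fun j => ‖c j‖ ^ 2) :
    Summable fun j => c j • e j := by
  rw [summable_iff_vanishing_norm]
  intro ε hε
  -- The denominator is `B + 1` because `B` may be zero.
  obtain ⟨s, hs⟩ := (summable_iff_vanishing_norm.mp hc) (ε ^ 2 / (B + 1)) (by positivity)
  refine ⟨s, fun t ht => ?_⟩
  have h1 := hs t ht
  rw [Real.norm_of_nonneg (by positivity), lt_div_iff₀ (by positivity)] at h1
  have h2 := h t c
  have h3 : 0 ≤ ∑ j ∈ t, ‖c j‖ ^ 2 := by positivity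
  exact lt_of_pow_lt_pow_left₀ 2 hε.le (by nlinarith)

theorem IsBessel.norm_sq_le_of_hasSum {B : ℝ} (hB : 0 ≤ B) {e : ι → H}
    (h : IsBessel B e) {c : ι → ℂ} (hc : Summable fun j => ‖c j‖ ^ 2) {f : H}
    (hf : HasSum (fun j => c j • e j) f) : ‖f‖ ^ 2 ≤ B * ∑' j, ‖c j‖ ^ 2 := by
  refine le_of_tendsto ((hf.norm).pow 2) (.of_forall fun s => (h s c).trans ?_)
  gcongr
  exact hc.sum_le_tsum s fun _ _ => by positivity

/-- The frame operator of a Bessel family. -/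
theorem IsBessel.exists_frameOperator [CompleteSpace H] {B : ℝ} (hB : 0 ≤ B) {e : ι → H}
    (h : IsBessel B e) :
    ∃ G : H →L[ℂ] H, (∀ f, HasSum (fun j => inner ℂ (e j) f • e j) (G f)) := by
  have hs (f : H) := h.summable_smul hB (h.summable_inner hB f)
  refine ⟨LinearMap.mkContinuous
    { toFun := fun f => ∑' j, inner ℂ (e j) f • e j
      map_add' := fun f g => ?_
      map_smul' := fun a f => ?_ } B fun f => ?_, fun f => (hs f).hasSum⟩
  · simp only [inner_add_right, add_smul]
    exact (hs f).tsum_add (hs g)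
  · simp only [inner_smul_right, mul_smul, RingHom.id_apply]
    exact (hs f).tsum_const_smul a
  · have h1 := h.norm_sq_le_of_hasSum hB (h.summable_inner hB f) (hs f).hasSum
    refine le_of_sq_le_sq ?_ (by positivity)
    refine h1.trans ((mul_le_mul_of_nonneg_left (h.tsum_inner_le hB f) hB).trans_eq ?_)
    ring

theorem inner_frameOperator_symm {e : ι → H} {G : H →L[ℂ] H}
    (hG : ∀ f, HasSum (fun j => inner ℂ (e j) f • e j) (G f)) (f g : H) :
    inner ℂ (G f) g = inner ℂ f (G g) := by
  have h1 := (innerSL ℂ f).hasSum (hG g)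
  have h2 := (innerSL ℂ g).hasSum (hG f)
  have h3 := Complex.hasSum_conj'.mpr h2
  simp only [innerSL_apply_apply, inner_smul_right, map_mul, inner_conj_symm] at h1 h3
  simp only [mul_comm (inner ℂ f _)] at h3
  exact h3.unique h1

theorem hasSum_inner_frameOperator {e : ι → H} {G : H →L[ℂ] H}
    (hG : ∀ f, HasSum (fun j => inner ℂ (e j) f • e j) (G f)) (f : H) :
    HasSum (fun j => ‖inner ℂ (e j) f‖ ^ 2) (RCLike.re (inner ℂ (G f) f)) := by
  have h1 := RCLike.hasSum_re ℂ ((innerSL ℂ f).hasSum (hG f))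
  rw [inner_frameOperator_symm hG]
  rw [innerSL_apply_apply] at h1
  convert h1 using 1
  funext j
  simp only [innerSL_apply_apply, inner_smul_right]
  rw [← inner_conj_symm f (e j), RCLike.mul_conj]
  norm_cast

/-- A Bessel family satisfying a lower frame bound has an invertible frame operator. -/
theorem IsBessel.exists_frameOperator_equiv [CompleteSpace H] {A B : ℝ} (hA : 0 < A) (hB : 0 ≤ B)
    {e : ι → H} (h : IsBessel B e) (hlow : ∀ f, A * ‖f‖ ^ 2 ≤ ∑' j, ‖inner ℂ (e j) f‖ ^ 2) :
    ∃ G : H ≃L[ℂ] H, (∀ f, HasSum (fun j => inner ℂ (e j) f • e j) (G f)) := by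
  obtain ⟨G, hG⟩ := h.exists_frameOperator hB
  have hlow' (f : H) : A * ‖f‖ ^ 2 ≤ ‖inner ℂ (G f) f‖ := by
    refine (hlow f).trans ?_
    rw [(hasSum_inner_frameOperator hG f).tsum_eq]
    exact (RCLike.abs_re_le_norm _).trans' (le_abs_self _)
  have hbd (f : H) : A * ‖f‖ ≤ ‖G f‖ := by
    rcases (norm_nonneg f).eq_or_lt with h0 | h0
    · rw [← h0]; simp
    · have := (hlow' f).trans (norm_inner_le_norm (G f) f)
      nlinarith
  -- Bounded below gives injectivity and closed range; surjectivity then only needs a trivial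
  -- orthogonal complement.
  have hanti : AntilipschitzWith (Real.toNNReal A⁻¹) G := by
    refine AddMonoidHomClass.antilipschitz_of_bound G fun f => ?_
    rw [Real.coe_toNNReal _ (by positivity), inv_mul_eq_div, le_div_iff₀ hA]
    linarith [hbd f]
  have hclosed : IsClosed (Set.range G) := hanti.isClosed_range G.uniformContinuous
  have hrange : LinearMap.range (G : H →ₗ[ℂ] H) = ⊤ := by
    have hc : IsClosed ((LinearMap.range (G : H →ₗ[ℂ] H) : Submodule ℂ H) : Set H) := by
      rw [LinearMap.coe_range]
      exact hclosed
    have : CompleteSpace (LinearMap.range (G : H →ₗ[ℂ] H)) := hc.completeSpace_coe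
    -- A vector `f` orthogonal to the range is orthogonal to `G f`, so coercivity forces `f = 0`.
    rw [← Submodule.orthogonal_eq_bot_iff, eq_bot_iff]
    intro f hf
    have h0 : inner ℂ (G f) f = 0 := hf (G f) ⟨f, rfl⟩
    have h1 := hlow' f
    rw [h0, norm_zero] at h1
    have h2 : ‖f‖ ^ 2 ≤ 0 := by nlinarith [sq_nonneg ‖f‖]
    simpa using le_antisymm h2 (sq_nonneg _)
  exact ⟨ContinuousLinearEquiv.ofBijective G (LinearMap.ker_eq_bot.mpr hanti.injective) hrange, hG⟩

end AbstractFrames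

section DualFrames

variable {H : Type*} [NormedAddCommGroup H] [InnerProductSpace ℂ H] {ι : Type*}
  {A B : ℝ} {V : Submodule ℂ H} {e : ι → H}

/-! ### Frames of subspaces and their duals -/

theorem IsBessel.of_subtype {e : ι → V} (h : IsBessel B e) :
    IsBessel B (fun j => (e j : H)) := by
  intro s c
  simpa using h s c

theorem IsFrame.bound_pos (h : IsFrame A B V e) : 0 < B := h.pos.trans_le h.le

theorem IsFrame.isBessel_subtype (h : IsFrame A B V e) :
    IsBessel B (fun j => (⟨e j, h.mem j⟩ : V)) := by
  refine .of_sum_inner_le h.bound_pos.le fun f s => ?_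
  exact ((h.summable f f.2).sum_le_tsum s fun _ _ => by positivity).trans (h.upper f f.2)

theorem IsFrame.isBessel (h : IsFrame A B V e) : IsBessel B e :=
  h.isBessel_subtype.of_subtype

/-- The operators live on `V` as a Hilbert space in its own right, while frame sums are stated in
`H`; this passes between the two. -/
theorem hasSum_subtype_iff {f : ι → V} {a : V} :
    HasSum (fun j => (f j : H)) a ↔ HasSum f a :=
  Topology.IsInducing.hasSum_iff (g := V.subtype) Topology.IsInducing.subtypeVal f a

theorem IsFrame.exists_frameOperator [CompleteSpace V] (h : IsFrame A B V e) :
    ∃ F : V ≃L[ℂ] V, IsFrameOperator V e (F : V →L[ℂ] V) := by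
  obtain ⟨F, hF⟩ := h.isBessel_subtype.exists_frameOperator_equiv h.pos h.bound_pos.le
    fun f => h.lower f f.2
  exact ⟨F, fun f => hasSum_subtype_iff.mpr (hF f)⟩

variable {F : V ≃L[ℂ] V}

theorem IsFrameOperator.hasSum_subtype (hF : IsFrameOperator V e (F : V →L[ℂ] V))
    (he : ∀ j, e j ∈ V) (f : V) :
    HasSum (fun j => inner ℂ (⟨e j, he j⟩ : V) f • (⟨e j, he j⟩ : V)) ((F : V →L[ℂ] V) f) :=
  hasSum_subtype_iff.mp (hF f)

theorem IsFrameOperator.inner_symm (hF : IsFrameOperator V e (F : V →L[ℂ] V))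
    (he : ∀ j, e j ∈ V) (f g : V) : inner ℂ (F f) g = inner ℂ f (F g) :=
  inner_frameOperator_symm (hF.hasSum_subtype he) f g

theorem IsFrameOperator.inner_inv_symm (hF : IsFrameOperator V e (F : V →L[ℂ] V))
    (he : ∀ j, e j ∈ V) (f g : V) : inner ℂ (F.symm f) g = inner ℂ f (F.symm g) := by
  have := hF.inner_symm he (F.symm f) (F.symm g)
  rw [F.apply_symm_apply, F.apply_symm_apply] at this
  exact this.symm

/-- The canonical dual family is dual. -/
theorem IsFrameOperator.isDualOn (hF : IsFrameOperator V e (F : V →L[ℂ] V))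
    (he : ∀ j, e j ∈ V) : IsDualOn V e (fun j => (F.symm ⟨e j, he j⟩ : H)) := by
  intro f hf
  constructor
  · have h := hF (F.symm ⟨f, hf⟩)
    rw [ContinuousLinearEquiv.coe_coe, F.apply_symm_apply] at h
    refine h.congr_fun fun j => ?_
    congr 1
    exact hF.inner_inv_symm he ⟨e j, he j⟩ ⟨f, hf⟩
  · have h := (F.symm : V →L[ℂ] V).hasSum (hF.hasSum_subtype he ⟨f, hf⟩)
    rw [ContinuousLinearEquiv.coe_coe, ContinuousLinearEquiv.coe_coe, F.symm_apply_apply] at h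
    refine (hasSum_subtype_iff.mpr h).congr_fun fun j => ?_
    rw [map_smul]
    rfl

/-- The frame operator of the canonical dual family is the inverse of the frame operator. -/
theorem IsFrameOperator.dual (hF : IsFrameOperator V e (F : V →L[ℂ] V)) (he : ∀ j, e j ∈ V) :
    IsFrameOperator V (fun j => (F.symm ⟨e j, he j⟩ : H)) (F.symm : V →L[ℂ] V) := by
  intro f
  have h1 : HasSum (fun j => inner ℂ (F.symm ⟨e j, he j⟩ : H) (f : H) • (⟨e j, he j⟩ : V)) f :=
    hasSum_subtype_iff.mp (hF.isDualOn he f f.2).1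
  refine (hasSum_subtype_iff.mpr ((F.symm : V →L[ℂ] V).hasSum h1)).congr_fun fun j => ?_
  rw [map_smul]
  rfl

/-- The canonical dual family of a frame is a frame with the inverse bounds. -/
theorem IsFrame.dual [CompleteSpace V] (h : IsFrame A B V e)
    (hF : IsFrameOperator V e (F : V →L[ℂ] V)) :
    IsFrame B⁻¹ A⁻¹ V (fun j => (F.symm ⟨e j, h.mem j⟩ : H)) := by
  have hA := h.pos
  have hB := h.bound_pos
  have hG := hF.hasSum_subtype h.mem
  -- The dual frame sum of `f` is the frame sum of `F⁻¹ f`, with value `⟨f, F⁻¹ f⟩`.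
  have key (f : V) : HasSum (fun j => ‖inner ℂ (F.symm ⟨e j, h.mem j⟩ : H) (f : H)‖ ^ 2)
      (RCLike.re (inner ℂ f (F.symm f))) := by
    have h1 := hasSum_inner_frameOperator hG (F.symm f)
    rw [ContinuousLinearEquiv.coe_coe, F.apply_symm_apply] at h1
    refine h1.congr_fun fun j => ?_
    rw [← hF.inner_inv_symm h.mem]
    rfl
  refine ⟨by positivity, inv_anti₀ hA h.le, fun j => SetLike.coe_mem _,
    fun f hf => (key ⟨f, hf⟩).summable, fun f hf => ?_, fun f hf => ?_⟩
  · rw [(key ⟨f, hf⟩).tsum_eq]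
    have h1 := hasSum_inner_frameOperator hG (F.symm ⟨f, hf⟩)
    -- With `g = F⁻¹ f`, the synthesis bound gives `‖f‖² = ‖F g‖² ≤ B ⟨F g, g⟩`, which is the lower
    -- bound `B⁻¹`.
    have h2 := h.isBessel_subtype.norm_sq_le_of_hasSum hB.le h1.summable (hG (F.symm ⟨f, hf⟩))
    rw [h1.tsum_eq] at h2
    simp only [ContinuousLinearEquiv.coe_coe, F.apply_symm_apply] at h2
    rw [inv_mul_le_iff₀ hB]
    exact h2
  · rw [(key ⟨f, hf⟩).tsum_eq]
    set g := F.symm ⟨f, hf⟩ with hg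
    have h1 := h.lower g g.2
    have h2 := hasSum_inner_frameOperator hG g
    have h3 : (F g : V) = ⟨f, hf⟩ := by rw [hg, F.apply_symm_apply]
    rw [ContinuousLinearEquiv.coe_coe, h3] at h2
    have h4 : ∑' j, ‖inner ℂ (e j) (g : H)‖ ^ 2 = RCLike.re (inner ℂ (⟨f, hf⟩ : V) g) := h2.tsum_eq
    rw [h4] at h1
    have h5 : RCLike.re (inner ℂ (⟨f, hf⟩ : V) g) ≤ ‖f‖ * ‖g‖ := by
      refine (re_inner_le_norm (𝕜 := ℂ) (⟨f, hf⟩ : V) g).trans_eq rfl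
    have h6 : ‖(g : H)‖ = ‖g‖ := rfl
    rw [h6] at h1
    -- From `A ‖g‖² ≤ ⟨f, g⟩ ≤ ‖f‖ ‖g‖`; hence `⟨f, g⟩ ≤ A⁻¹ ‖f‖²`.
    have h7 : ‖g‖ ≤ A⁻¹ * ‖f‖ := by
      rw [inv_mul_eq_div, le_div_iff₀ hA]
      rcases (norm_nonneg g).eq_or_lt with h0 | h0
      · rw [← h0]; simp
      · nlinarith [h1.trans h5]
    refine h5.trans ((mul_le_mul_of_nonneg_left h7 (norm_nonneg f)).trans_eq ?_)
    ring

/-! ### Riesz families -/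

/-- Some `c j` may vanish, so the support can be smaller than `s`; the missing terms are zero. This
frees the Riesz inequalities from finitely supported functions. -/
theorem sum_support_indicator {M : Type*} [AddCommMonoid M] (s : Finset ι) (c : ι → ℂ)
    (g : ι → ℂ → M) (hg : ∀ j, g j 0 = 0) :
    ∑ j ∈ (Finsupp.indicator s fun j _ => c j).support,
      g j ((Finsupp.indicator s fun j _ => c j) j) = ∑ j ∈ s, g j (c j) := by
  classical
  rw [Finset.sum_subset (Finsupp.support_indicator_subset s fun j _ => c j)
    (fun j _ hj => by rw [Finsupp.notMem_support_iff.mp hj, hg])]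
  exact Finset.sum_congr rfl fun j hj => by rw [Finsupp.indicator_of_mem hj]

theorem IsRieszFamily.lower_finset (h : IsRieszFamily A B e) (s : Finset ι) (c : ι → ℂ) :
    A * ∑ j ∈ s, ‖c j‖ ^ 2 ≤ ‖∑ j ∈ s, c j • e j‖ ^ 2 := by
  have h1 := h.lower (Finsupp.indicator s fun j _ => c j)
  rwa [sum_support_indicator s c (fun _ z => ‖z‖ ^ 2) (by simp),
    sum_support_indicator s c (fun j z => z • e j) (by simp)] at h1

theorem IsRieszFamily.isBessel (h : IsRieszFamily A B e) : IsBessel B e := by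
  intro s c
  have h1 := h.upper (Finsupp.indicator s fun j _ => c j)
  rwa [sum_support_indicator s c (fun _ z => ‖z‖ ^ 2) (by simp),
    sum_support_indicator s c (fun j z => z • e j) (by simp)] at h1

/-- A Riesz family is a frame for its closed span, with the same bounds. -/
theorem IsRieszFamily.isFrame [CompleteSpace H] (h : IsRieszFamily A B e) :
    IsFrame A B (Submodule.span ℂ (Set.range e)).topologicalClosure e := by
  have hA := h.pos
  have hB : 0 ≤ B := (h.pos.trans_le h.le).le
  obtain ⟨G, hG⟩ := h.isBessel.exists_frameOperator hB
  refine ⟨h.pos, h.le, fun j => Submodule.le_topologicalClosure _ (Submodule.subset_span ⟨j, rfl⟩),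
    fun f _ => h.isBessel.summable_inner hB f, fun f hf => ?_,
    fun f _ => h.isBessel.tsum_inner_le hB f⟩
  rw [(hasSum_inner_frameOperator hG f).tsum_eq]
  -- Written as a quadratic form of `G`, the lower frame inequality is a closed condition, so the
  -- span suffices.
  have hc : IsClosed {f : H | A * ‖f‖ ^ 2 ≤ RCLike.re (inner ℂ (G f) f)} :=
    isClosed_le (by fun_prop) (by fun_prop)
  refine closure_minimal (s := (Submodule.span ℂ (Set.range e) : Set H)) ?_ hc hf
  intro f hf
  obtain ⟨c, rfl⟩ := Finsupp.mem_span_range_iff_exists_finsupp.mp hf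
  change A * _ ≤ _
  rw [← (hasSum_inner_frameOperator hG _).tsum_eq]
  rw [Finsupp.sum]
  -- For `f = ∑ c_j e_j`, Cauchy-Schwarz gives `‖f‖⁴ ≤ (∑ |c_j|²) ∑ |⟨f, e_j⟩|²`, and the Riesz
  -- lower bound gives `A ∑ |c_j|² ≤ ‖f‖²`.
  have h1 := norm_inner_sum_smul_sq_le e c.support c (∑ j ∈ c.support, c j • e j)
  have h2 := h.lower c
  rw [norm_inner_self_eq] at h1
  set f := ∑ j ∈ c.support, c j • e j
  have h3 : ∑ j ∈ c.support, ‖inner ℂ (e j) f‖ ^ 2 ≤ ∑' j, ‖inner ℂ (e j) f‖ ^ 2 :=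
    (h.isBessel.summable_inner hB f).sum_le_tsum _ fun _ _ => by positivity
  have h4 : 0 ≤ ∑ j ∈ c.support, ‖inner ℂ (e j) f‖ ^ 2 := by positivity
  rcases (sq_nonneg ‖f‖).eq_or_lt with h0 | h0
  · rw [← h0]; linarith
  · refine le_trans ?_ h3
    have h5 : A * (‖f‖ ^ 2) ^ 2 ≤ ‖f‖ ^ 2 * ∑ j ∈ c.support, ‖inner ℂ (e j) f‖ ^ 2 := by
      refine (mul_le_mul_of_nonneg_left h1 hA.le).trans ?_
      rw [← mul_assoc]
      gcongr
    nlinarith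

/-- The lower Riesz bound on finite sets containing `i` survives the limit of the partial sums. -/
theorem IsRieszFamily.eq_zero_of_hasSum (h : IsRieszFamily A B e) {c : ι → ℂ}
    (hc : HasSum (fun j => c j • e j) 0) (i : ι) : c i = 0 := by
  classical
  have h1 : A * ‖c i‖ ^ 2 ≤ ‖(0 : H)‖ ^ 2 := by
    refine ge_of_tendsto (hc.norm.pow 2) ?_
    filter_upwards [Filter.eventually_ge_atTop {i}] with s hs
    refine le_trans ?_ (h.lower_finset s c)
    refine mul_le_mul_of_nonneg_left ?_ h.pos.le
    exact Finset.single_le_sum (f := fun j => ‖c j‖ ^ 2) (fun _ _ => by positivity)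
      (Finset.singleton_subset_iff.mp hs)
  have hA := h.pos
  rw [norm_zero] at h1
  have h2 : ‖c i‖ ^ 2 ≤ 0 := by nlinarith [sq_nonneg ‖c i‖]
  simpa using le_antisymm h2 (sq_nonneg _)

/-- The vector `e_i` has both its dual expansion and the trivial one; uniqueness of coefficients
identifies them. -/
theorem IsRieszFamily.isBiorthogonal (h : IsRieszFamily A B e) (he : ∀ j, e j ∈ V) {g : ι → H}
    (hg : IsDualOn V e g) : IsBiorthogonal e g := by
  classical
  have key (i j : ι) : inner ℂ (g j) (e i) = if j = i then 1 else 0 := by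
    have h1 := (hg (e i) (he i)).1
    have h2 : HasSum (fun j => (if j = i then (1 : ℂ) else 0) • e j) (e i) := by
      convert hasSum_ite_eq i (e i) using 2 with j
      split_ifs with hj
      · rw [hj, one_smul]
      · rw [zero_smul]
    have h3 := h1.sub h2
    simp only [← sub_smul, sub_self] at h3
    exact sub_eq_zero.mp (h.eq_zero_of_hasSum h3 j)
  exact ⟨fun j => by rw [key, if_pos rfl], fun i j hij => by rw [key, if_neg (Ne.symm hij)]⟩

/-- Biorthogonality recovers `c_j` as the inner product of `∑ c_i g_i` with `e_j`, so the lower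
bound for `g` is the Bessel bound for `e`. -/
theorem IsBiorthogonal.isRieszFamily {g : ι → H} (hA : 0 < A) (hAB : A ≤ B) (h : IsBessel B e)
    (hb : IsBiorthogonal e g) (hg : IsBessel A⁻¹ g) : IsRieszFamily B⁻¹ A⁻¹ g := by
  classical
  have hB := hA.trans_le hAB
  refine ⟨by positivity, inv_anti₀ hA hAB, fun c => ?_, fun c => hg _ _⟩
  set f := ∑ j ∈ c.support, c j • g j with hf
  have h1 : ∀ j ∈ c.support, inner ℂ (e j) f = c j := by
    intro j hj
    rw [hf, inner_sum, Finset.sum_eq_single j]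
    · rw [inner_smul_right, ← inner_conj_symm, hb.1, map_one, mul_one]
    · intro i _ hij
      rw [inner_smul_right, ← inner_conj_symm, hb.2 j i hij.symm, map_zero, mul_zero]
    · exact fun hj' => absurd hj hj'
  rw [inv_mul_le_iff₀ hB]
  refine le_trans (le_of_eq ?_) (h.sum_inner_le hB.le f c.support)
  exact Finset.sum_congr rfl fun j hj => by rw [h1 j hj]

end DualFrames

/-! ### The Hilbert space `Hˢ` and its shifts -/

section Sobolev

variable {n : ℕ} {s : ℝ}

theorem weight_hasTemperateGrowth (s : ℝ) :
    (fun x : Rn n => ((weight s x : ℝ) : ℂ)).HasTemperateGrowth := by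
  unfold weight
  fun_prop

theorem Hs.weightedFourier_eq_of {f : Hs n s} {h : Lp ℂ 2 (volume : Measure (Rn n))}
    (hf : smulLeftCLM ℂ (fun x : Rn n => ((weight s x : ℝ) : ℂ)) (𝓕 f.toDistr) =
      Lp.toTemperedDistributionCLM ℂ volume 2 h) : f.weightedFourier = h :=
  toDistr_Lp_injective (f.weightedFourier_spec.symm.trans hf)

/-- A preimage is the Bessel potential of order `-s` of the inverse Fourier transform. Completeness
of `Hˢ` is then inherited from `L²`. -/
theorem Hs.weightedFourier_surjective :
    Function.Surjective (Hs.weightedFourier : Hs n s →ₗ[ℂ] _) := by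
  intro h
  set f : 𝓢'(Rn n, ℂ) :=
    besselPotential (Rn n) ℂ (-s) (𝓕⁻ (Lp.toTemperedDistributionCLM ℂ volume 2 h)) with hf
  have h1 : smulLeftCLM ℂ (fun x : Rn n => ((weight s x : ℝ) : ℂ)) (𝓕 f) =
      Lp.toTemperedDistributionCLM ℂ volume 2 h := by
    have h2 := fourier_besselPotential_eq_smulLeftCLM_fourier_apply s f
    rw [hf, besselPotential_besselPotential_apply, neg_add_cancel, besselPotential_zero,
      ContinuousLinearMap.id_apply, fourier_fourierInv_eq, ← hf] at h2
    exact h2.symm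
  exact ⟨⟨f, memSobolev_iff_exists_smulLeftCLM_fourier.mpr ⟨h, h1⟩⟩, Hs.weightedFourier_eq_of h1⟩

/-- `Hˢ` is isometrically isomorphic to `L²` through the weighted Fourier transform. -/
noncomputable def Hs.weightedFourierₗᵢ : Hs n s →ₗᵢ[ℂ] Lp ℂ 2 (volume : Measure (Rn n)) where
  toLinearMap := Hs.weightedFourier
  norm_map' _ := rfl

instance : CompleteSpace (Hs n s) :=
  (LinearIsometryEquiv.ofSurjective Hs.weightedFourierₗᵢ
    Hs.weightedFourier_surjective).toIsometryEquiv.completeSpace_iff.mpr inferInstance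

theorem phase_memLp_top (a : Rn n) : MemLp (phase a) ∞ (volume : Measure (Rn n)) :=
  memLp_top_of_bound (phase_hasTemperateGrowth a).1.continuous.aestronglyMeasurable 1
    (.of_forall fun x => (norm_phase a x).le)

/-- Translation becomes a phase under the Fourier transform, and multiplication by the phase
commutes with multiplication by the weight. -/
theorem Hs.weightedFourier_shift (k : Zn n) (f : Hs n s) :
    (shift k f).weightedFourier =
      (phase_memLp_top (latticePt k)).toLp (phase (latticePt k)) • f.weightedFourier := by
  apply Hs.weightedFourier_eq_of
  rw [Lp.toTemperedDistributionCLM_apply,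
    Lp.toTemperedDistribution_smul_eq (phase_hasTemperateGrowth _),
    ← Lp.toTemperedDistributionCLM_apply, ← f.weightedFourier_spec]
  change smulLeftCLM ℂ _ (𝓕 (translate (latticePt k) f.toDistr)) = _
  rw [fourier_translate,
    smulLeftCLM_smulLeftCLM_apply (phase_hasTemperateGrowth _) (weight_hasTemperateGrowth s),
    mul_comm]
  exact (smulLeftCLM_smulLeftCLM_apply (weight_hasTemperateGrowth s)
    (phase_hasTemperateGrowth (latticePt k)) (𝓕 f.toDistr)).symm

theorem Hs.coeFn_weightedFourier_shift (k : Zn n) (f : Hs n s) :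
    (shift k f).weightedFourier =ᵐ[volume] fun x => phase (latticePt k) x * f.weightedFourier x := by
  rw [Hs.weightedFourier_shift]
  filter_upwards [Lp.coeFn_lpSMul (r := 2) ((phase_memLp_top (latticePt k)).toLp _)
    f.weightedFourier, (phase_memLp_top (latticePt k)).coeFn_toLp] with x h1 h2
  rw [h1, Pi.smul_apply', h2, smul_eq_mul]

theorem norm_shift (k : Zn n) (f : Hs n s) : ‖shift k f‖ = ‖f‖ := by
  change ‖(shift k f).weightedFourier‖ = ‖f.weightedFourier‖
  rw [Lp.norm_def, Lp.norm_def]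
  congr 1
  refine eLpNorm_congr_norm_ae ?_
  filter_upwards [Hs.coeFn_weightedFourier_shift k f] with x hx
  rw [hx, norm_mul, norm_phase, one_mul]

/-- The shift `T_k` as a linear isometry of `Hˢ`. -/
noncomputable def shiftₗᵢ (k : Zn n) : Hs n s →ₗᵢ[ℂ] Hs n s where
  toFun := shift k
  map_add' f g := Subtype.ext (map_add (translate (latticePt k)) f.toDistr g.toDistr)
  map_smul' c f := Subtype.ext (map_smul (translate (latticePt k)) c f.toDistr)
  norm_map' := norm_shift k

theorem shiftₗᵢ_apply (k : Zn n) (f : Hs n s) : shiftₗᵢ k f = shift k f := rfl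

theorem shift_shift (k l : Zn n) (f : Hs n s) : shift k (shift l f) = shift (k + l) f := by
  apply Subtype.ext
  refine DFunLike.ext _ _ fun ψ => ?_
  change f.toDistr _ = f.toDistr _
  congr 1
  ext x
  change ψ _ = ψ _
  congr 1
  change x - -latticePt l - -latticePt k = x - -latticePt (k + l)
  have h : latticePt (k + l) = latticePt k + latticePt l := by
    ext j; simp [latticePt]
  rw [h]
  module

theorem inner_shift_shift (k : Zn n) (f g : Hs n s) :
    inner ℂ (shift k f) (shift k g) = inner ℂ f g :=
  (shiftₗᵢ k).inner_map_map f g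

end Sobolev

/-! ### Shift-invariant spaces and operators commuting with shifts -/

section ShiftInvariant

variable {n : ℕ} {s : ℝ} {I : Type*} (φ : I → Hs n s)

theorem isShiftInvariant_shiftSpan : IsShiftInvariant (shiftSpan φ) := by
  intro k f hf
  refine map_mem_closure (shiftₗᵢ k).continuous hf fun g hg => ?_
  rw [SetLike.mem_coe] at hg ⊢
  induction hg using Submodule.span_induction with
  | mem g hg =>
    obtain ⟨⟨l, i⟩, rfl⟩ := hg
    exact Submodule.subset_span ⟨(k + l, i), (shift_shift k l (φ i)).symm⟩
  | zero => exact (map_zero (shiftₗᵢ (s := s) k)).symm ▸ zero_mem _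
  | add g h _ _ hg hh =>
    change shiftₗᵢ k (g + h) ∈ Submodule.span ℂ _
    rw [map_add]
    exact add_mem hg hh
  | smul c g _ hg =>
    change shiftₗᵢ k (c • g) ∈ Submodule.span ℂ _
    rw [map_smul]
    exact Submodule.smul_mem _ c hg

instance : CompleteSpace (shiftSpan φ) :=
  inferInstanceAs (CompleteSpace (Submodule.topologicalClosure _))

theorem shifts_mem_shiftSpan (p : Zn n × I) : shifts φ p ∈ shiftSpan φ :=
  Submodule.le_topologicalClosure _ (Submodule.subset_span ⟨p, rfl⟩)

variable {φ}

/-- The frame operator of the shifts commutes with the shifts. -/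
theorem IsFrameOperator.map_shift {F : shiftSpan φ →L[ℂ] shiftSpan φ}
    (hF : IsFrameOperator (shiftSpan φ) (shifts φ) F) (k : Zn n) (f : shiftSpan φ) :
    F ⟨shift k f, isShiftInvariant_shiftSpan φ k f f.2⟩ =
      ⟨shift k (F f), isShiftInvariant_shiftSpan φ k _ (F f).2⟩ := by
  apply Subtype.ext
  have h1 := (shiftₗᵢ k).toContinuousLinearMap.hasSum (hF f)
  have h2 := hF ⟨shift k f, isShiftInvariant_shiftSpan φ k f f.2⟩
  -- `T_k` permutes the family, sending index `(l, i)` to `(k + l, i)`, and preserves inner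
  -- products; so both series have the same terms.
  rw [← ((Equiv.addLeft k).prodCongr (Equiv.refl I)).hasSum_iff] at h2
  refine h2.unique (h1.congr_fun fun p => ?_)
  have h3 : shifts φ (((Equiv.addLeft k).prodCongr (Equiv.refl I)) p) = shift k (shifts φ p) :=
    (shift_shift k p.1 (φ p.2)).symm
  simp only [Function.comp_apply, h3, inner_shift_shift, map_smul]
  rfl

theorem IsFrameOperator.symm_map_shift {F : shiftSpan φ ≃L[ℂ] shiftSpan φ}
    (hF : IsFrameOperator (shiftSpan φ) (shifts φ) (F : shiftSpan φ →L[ℂ] shiftSpan φ))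
    (k : Zn n) (f : shiftSpan φ) :
    F.symm ⟨shift k f, isShiftInvariant_shiftSpan φ k f f.2⟩ =
      ⟨shift k (F.symm f), isShiftInvariant_shiftSpan φ k _ (F.symm f).2⟩ := by
  rw [ContinuousLinearEquiv.symm_apply_eq]
  have h := hF.map_shift k (F.symm f)
  rw [ContinuousLinearEquiv.coe_coe] at h
  rw [h]
  simp

end ShiftInvariant

/-! ### Fibers -/

section Tiling

variable {n : ℕ}

theorem latticePt_apply (k : Zn n) (j : Fin n) : latticePt k j = k j := rfl

theorem measurableSet_cube (n : ℕ) : MeasurableSet (cube n) := by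
  have h : cube n = ⋂ j, (fun t : Rn n => t j) ⁻¹' Set.Ico (-(1 / 2) : ℝ) (1 / 2) := by
    ext t; simp [cube]
  rw [h]
  refine MeasurableSet.iInter fun j => measurableSet_Ico.preimage ?_
  fun_prop

theorem iUnion_cube_sub_latticePt :
    ⋃ k : Zn n, (fun x : Rn n => x - latticePt k) ⁻¹' cube n = Set.univ := by
  refine Set.eq_univ_of_forall fun x => Set.mem_iUnion.mpr ⟨fun j => ⌊x j + 1 / 2⌋, fun j => ?_⟩
  rw [PiLp.sub_apply, latticePt_apply]
  have h1 := Int.floor_le (x j + 1 / 2)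
  have h2 := Int.lt_floor_add_one (x j + 1 / 2)
  constructor <;> linarith

theorem pairwise_disjoint_cube_sub_latticePt :
    Pairwise (Function.onFun Disjoint
      fun k : Zn n => (fun x : Rn n => x - latticePt k) ⁻¹' cube n) := by
  intro k l hkl
  refine Set.disjoint_left.mpr fun x hk hl => hkl (funext fun j => ?_)
  have h1 := hk j
  have h2 := hl j
  rw [PiLp.sub_apply, latticePt_apply] at h1 h2
  have h3 : (k j : ℝ) < l j + 1 := by linarith [h1.1, h2.2]
  have h4 : (l j : ℝ) < k j + 1 := by linarith [h2.1, h1.2]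
  have h5 : k j < l j + 1 := by exact_mod_cast h3
  have h6 : l j < k j + 1 := by exact_mod_cast h4
  omega

/-- The translates of the cube by the lattice tile the space. -/
theorem lintegral_eq_tsum_cube (g : Rn n → ℝ≥0∞) :
    ∫⁻ x, g x = ∑' k : Zn n, ∫⁻ t in cube n, g (t + latticePt k) := by
  rw [← setLIntegral_univ, ← iUnion_cube_sub_latticePt,
    lintegral_iUnion (fun k => (measurableSet_cube n).preimage (by fun_prop))
      pairwise_disjoint_cube_sub_latticePt]
  refine tsum_congr fun k => ?_
  have h := (measurePreserving_sub_right (volume : Measure (Rn n)) (latticePt k)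
    ).setLIntegral_comp_preimage_emb (MeasurableEquiv.subRight (latticePt k)).measurableEmbedding
    (fun t => g (t + latticePt k)) (cube n)
  simpa only [sub_add_cancel] using h

/-- A fiber samples an `L²` class on a whole coset of the lattice; countability of the lattice keeps
the exceptional set null. -/
theorem ae_cube_forall_latticePt {P : Rn n → Prop} (h : ∀ᵐ x, P x) :
    ∀ᵐ t ∂(volume.restrict (cube n)), ∀ k : Zn n, P (t + latticePt k) :=
  ae_restrict_of_ae (ae_all_iff.mpr fun k =>
    (measurePreserving_add_right (volume : Measure (Rn n)) (latticePt k)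
      ).quasiMeasurePreserving.ae h)

/-- Two lattice points have integer inner product. This periodicity makes `T_k` act on each fiber as
a scalar. -/
theorem phase_add_latticePt (k l : Zn n) (t : Rn n) :
    phase (latticePt k) (t + latticePt l) = phase (latticePt k) t := by
  have h : inner ℝ (latticePt l) (latticePt k) = ((∑ j, k j * l j : ℤ) : ℝ) := by
    rw [PiLp.inner_apply]
    push_cast
    rfl
  rw [phase, phase, inner_add_left, h, Complex.exp_eq_exp_iff_exists_int]
  refine ⟨-∑ j, k j * l j, ?_⟩
  push_cast
  ring

end Tiling

/-! ### The fiber map as an isometry -/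

section Fiber

variable {n : ℕ} {s : ℝ}

theorem aestronglyMeasurable_weightedFourier_add (f : Hs n s) (k : Zn n) :
    AEStronglyMeasurable (fun t => f.weightedFourier (t + latticePt k))
      (volume.restrict (cube n)) :=
  ((Lp.aestronglyMeasurable f.weightedFourier).comp_quasiMeasurePreserving
    (measurePreserving_add_right (volume : Measure (Rn n)) (latticePt k)
      ).quasiMeasurePreserving).restrict

theorem lintegral_cube_tsum_weightedFourier (f : Hs n s) :
    ∫⁻ t in cube n, ∑' k : Zn n, ‖f.weightedFourier (t + latticePt k)‖ₑ ^ 2 = ‖f‖ₑ ^ 2 := by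
  rw [lintegral_tsum fun k => (aestronglyMeasurable_weightedFourier_add f k).enorm.pow_const 2,
    ← lintegral_eq_tsum_cube fun x => ‖f.weightedFourier x‖ₑ ^ 2]
  have h : ‖f‖ₑ = eLpNorm f.weightedFourier 2 volume := Lp.enorm_def _
  rw [h, eLpNorm_eq_lintegral_rpow_enorm_toReal (by norm_num) (by norm_num),
    ← ENNReal.rpow_natCast, ← ENNReal.rpow_mul]
  simp

/-- By Tonelli and the tiling, the sum of squares over the lattice has finite integral over the
cube, hence is finite almost everywhere. -/
theorem ae_memℓp_weightedFourier (f : Hs n s) : ∀ᵐ t ∂(volume.restrict (cube n)),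
    Memℓp (fun k : Zn n => f.weightedFourier (t + latticePt k)) 2 := by
  have h := ae_lt_top' (AEMeasurable.tsum fun k =>
    (aestronglyMeasurable_weightedFourier_add f k).enorm.pow_const 2)
    ((lintegral_cube_tsum_weightedFourier f).trans_ne (ENNReal.pow_ne_top enorm_ne_top))
  filter_upwards [h] with t ht
  rw [memℓp_gen_iff (by norm_num)]
  have h2 := ENNReal.summable_toReal ht.ne
  simpa using h2

/-- The sequence underlying the fiber. -/
theorem ae_mulWeight_fiber (f : Hs n s) : ∀ᵐ t ∂(volume.restrict (cube n)),
    ∀ k, Ell2.mulWeight n s (fiber f t) k = f.weightedFourier (t + latticePt k) := by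
  filter_upwards [ae_memℓp_weightedFourier f] with t ht k
  have hw (k : Zn n) : (weight s (latticePt k) : ℂ) ≠ 0 :=
    Complex.ofReal_ne_zero.mpr (weight_pos s (latticePt k)).ne'
  have h : (fun k : Zn n => f.weightedFourier (t + latticePt k) / (weight s (latticePt k) : ℂ)) ∈
      weightedSubmodule n s := by
    change Memℓp _ 2
    convert ht using 2 with k
    rw [mul_div_cancel₀ _ (hw k)]
  have h2 : fiber f t = ⟨_, h⟩ := dif_pos h
  rw [h2]
  exact mul_div_cancel₀ _ (hw k)

theorem ae_fiber_add (f g : Hs n s) : ∀ᵐ t ∂(volume.restrict (cube n)),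
    fiber (f + g) t = fiber f t + fiber g t := by
  filter_upwards [ae_mulWeight_fiber f, ae_mulWeight_fiber g, ae_mulWeight_fiber (f + g),
    ae_cube_forall_latticePt (Lp.coeFn_add f.weightedFourier g.weightedFourier)] with t h1 h2 h3 h4
  refine (Ell2.mulWeight n s).injective (lp.ext (funext fun k => ?_))
  rw [h3, map_add, map_add, h4, Pi.add_apply, lp.coeFn_add, Pi.add_apply, h1, h2]

theorem ae_fiber_smul (c : ℂ) (f : Hs n s) : ∀ᵐ t ∂(volume.restrict (cube n)),
    fiber (c • f) t = c • fiber f t := by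
  filter_upwards [ae_mulWeight_fiber f, ae_mulWeight_fiber (c • f),
    ae_cube_forall_latticePt (Lp.coeFn_smul c f.weightedFourier)] with t h1 h3 h4
  refine (Ell2.mulWeight n s).injective (lp.ext (funext fun k => ?_))
  rw [h3, map_smul, map_smul, h4, Pi.smul_apply, lp.coeFn_smul, Pi.smul_apply, h1]

theorem ae_fiber_shift (k : Zn n) (f : Hs n s) : ∀ᵐ t ∂(volume.restrict (cube n)),
    fiber (shift k f) t = phase (latticePt k) t • fiber f t := by
  filter_upwards [ae_mulWeight_fiber f, ae_mulWeight_fiber (shift k f),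
    ae_cube_forall_latticePt (Hs.coeFn_weightedFourier_shift k f)] with t h1 h3 h4
  refine (Ell2.mulWeight n s).injective (lp.ext (funext fun l => ?_))
  rw [h3, map_smul, h4, lp.coeFn_smul, Pi.smul_apply, h1, phase_add_latticePt, smul_eq_mul]

/-- The fiber is the pointwise limit of its finite truncations in the coordinate basis, each a
measurable combination of fixed vectors. -/
theorem aestronglyMeasurable_fiber (f : Hs n s) :
    AEStronglyMeasurable (fiber f) (volume.restrict (cube n)) := by
  classical
  let b (k : Zn n) : Ell2 n s := (Ell2.mulWeight n s).symm (lp.single 2 k 1)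
  refine aestronglyMeasurable_of_tendsto_ae (Filter.atTop : Filter (Finset (Zn n)))
    (f := fun S t => ∑ k ∈ S, f.weightedFourier (t + latticePt k) • b k) (fun S => ?_) ?_
  · exact Finset.aestronglyMeasurable_fun_sum S fun k _ =>
      (aestronglyMeasurable_weightedFourier_add f k).smul_const (b k)
  · filter_upwards [ae_mulWeight_fiber f] with t ht
    refine (Ell2.isometry_mulWeight n s).isEmbedding.tendsto_nhds_iff.mpr ?_
    refine (lp.hasSum_single ENNReal.ofNat_ne_top (Ell2.mulWeight n s (fiber f t))).congr fun S => ?_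
    rw [Function.comp_apply, map_sum]
    refine Finset.sum_congr rfl fun k _ => ?_
    rw [map_smul, LinearEquiv.apply_symm_apply, ← ht, ← lp.single_smul, smul_eq_mul, mul_one]

theorem ae_enorm_fiber_sq (f : Hs n s) : ∀ᵐ t ∂(volume.restrict (cube n)),
    ‖fiber f t‖ₑ ^ 2 = ∑' k : Zn n, ‖f.weightedFourier (t + latticePt k)‖ₑ ^ 2 := by
  filter_upwards [ae_mulWeight_fiber f] with t ht
  have h := lp.hasSum_norm (p := 2) (by norm_num) (Ell2.mulWeight n s (fiber f t))
  have h0 : ‖Ell2.mulWeight n s (fiber f t)‖ = ‖fiber f t‖ := rfl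
  simp only [ENNReal.toReal_ofNat, Real.rpow_ofNat, h0, ht] at h
  rw [← ofReal_norm, ← ENNReal.ofReal_pow (norm_nonneg _), ← h.tsum_eq,
    ENNReal.ofReal_tsum_of_nonneg (fun _ => by positivity) h.summable]
  refine tsum_congr fun k => ?_
  rw [← ofReal_norm, ← ENNReal.ofReal_pow (norm_nonneg _)]

theorem lintegral_enorm_fiber_sq (f : Hs n s) :
    ∫⁻ t in cube n, ‖fiber f t‖ₑ ^ 2 = ‖f‖ₑ ^ 2 := by
  rw [← lintegral_cube_tsum_weightedFourier]
  exact lintegral_congr_ae (ae_enorm_fiber_sq f)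

theorem eLpNorm_fiber (f : Hs n s) :
    eLpNorm (fiber f) 2 (volume.restrict (cube n)) = ‖f‖ₑ := by
  rw [eLpNorm_eq_lintegral_rpow_enorm_toReal (by norm_num) (by norm_num)]
  simp only [ENNReal.toReal_ofNat, ENNReal.rpow_ofNat]
  rw [lintegral_enorm_fiber_sq, ← ENNReal.rpow_natCast, ← ENNReal.rpow_mul]
  simp

theorem memLp_fiber (f : Hs n s) : MemLp (fiber f) 2 (volume.restrict (cube n)) :=
  ⟨aestronglyMeasurable_fiber f, (eLpNorm_fiber f).trans_lt enorm_lt_top⟩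

/-- The fiber map as a linear isometry of `Hˢ` into the square integrable `ℓ²_s`-valued functions
on the cube. -/
noncomputable def fiberₗᵢ : Hs n s →ₗᵢ[ℂ] Lp (Ell2 n s) 2 (volume.restrict (cube n)) where
  toFun f := (memLp_fiber f).toLp (fiber f)
  map_add' f g := (MemLp.toLp_eq_toLp_iff (memLp_fiber (f + g))
    ((memLp_fiber f).add (memLp_fiber g))).mpr (ae_fiber_add f g)
  map_smul' c f := (MemLp.toLp_eq_toLp_iff (memLp_fiber (c • f))
    ((memLp_fiber f).const_smul c)).mpr (ae_fiber_smul c f)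
  norm_map' f := by
    change ‖(memLp_fiber f).toLp (fiber f)‖ = ‖f‖
    rw [Lp.norm_toLp, eLpNorm_fiber, toReal_enorm]

theorem coeFn_fiberₗᵢ (f : Hs n s) : fiberₗᵢ f =ᵐ[volume.restrict (cube n)] fiber f :=
  (memLp_fiber f).coeFn_toLp

theorem ae_fiber_sub (f g : Hs n s) : ∀ᵐ t ∂(volume.restrict (cube n)),
    fiber (f - g) t = fiber f t - fiber g t := by
  have h := map_sub fiberₗᵢ f g
  filter_upwards [coeFn_fiberₗᵢ f, coeFn_fiberₗᵢ g, coeFn_fiberₗᵢ (f - g),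
    Lp.coeFn_sub (fiberₗᵢ f) (fiberₗᵢ g)] with t h1 h2 h3 h4
  rw [← h1, ← h2, ← h3, h, h4, Pi.sub_apply]

theorem ae_fiber_sum {ι : Type*} (S : Finset ι) (f : ι → Hs n s) :
    ∀ᵐ t ∂(volume.restrict (cube n)), fiber (∑ j ∈ S, f j) t = ∑ j ∈ S, fiber (f j) t := by
  classical
  have h0 : ∀ᵐ t ∂(volume.restrict (cube n)), fiber (0 : Hs n s) t = 0 := by
    filter_upwards [ae_fiber_sub (0 : Hs n s) 0] with t ht
    rw [sub_self, sub_self] at ht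
    exact ht
  induction S using Finset.induction_on with
  | empty => simpa using h0
  | insert j S hj ih =>
    filter_upwards [ih, ae_fiber_add (f j) (∑ j ∈ S, f j)] with t h1 h2
    rw [Finset.sum_insert hj, Finset.sum_insert hj, h2, h1]

theorem integral_inner_fiber (f g : Hs n s) :
    ∫ t in cube n, inner ℂ (fiber f t) (fiber g t) = inner ℂ f g := by
  rw [← fiberₗᵢ.inner_map_map, L2.inner_def]
  refine integral_congr_ae ?_
  filter_upwards [coeFn_fiberₗᵢ f, coeFn_fiberₗᵢ g] with t h1 h2
  rw [h1, h2]

/-- A convergent sequence in `Hˢ` has a subsequence with almost everywhere convergent fibers. -/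
theorem exists_subseq_tendsto_fiber {u : ℕ → Hs n s} {f : Hs n s}
    (hu : Filter.Tendsto u Filter.atTop (nhds f)) :
    ∃ ns : ℕ → ℕ, StrictMono ns ∧ ∀ᵐ t ∂(volume.restrict (cube n)),
      Filter.Tendsto (fun i => fiber (u (ns i)) t) Filter.atTop (nhds (fiber f t)) := by
  obtain ⟨ns, hns, h⟩ := (tendstoInMeasure_of_tendsto_Lp
    ((fiberₗᵢ.continuous.tendsto f).comp hu)).exists_seq_tendsto_ae
  refine ⟨ns, hns, ?_⟩
  filter_upwards [h, coeFn_fiberₗᵢ f, ae_all_iff.mpr fun m => coeFn_fiberₗᵢ (u m)] with t h1 h2 h3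
  simp only [Function.comp_apply, h2, h3] at h1
  exact h1

end Fiber

/-! ### The exponential basis of `L²` of the cube -/

section Exponentials

/-- The Haar probability measure of the torus. -/
noncomputable abbrev torusMeasure (n : ℕ) : Measure (Fin n → UnitAddCircle) :=
  Measure.pi fun _ => AddCircle.haarAddCircle

theorem exists_hilbertBasis_torus (n : ℕ) :
    ∃ b : HilbertBasis (Zn n) ℂ (Lp ℂ 2 (torusMeasure n)), ∀ k,
      b k =ᵐ[torusMeasure n] UnitAddTorus.mFourier k := by
  refine ⟨UnitAddTorus.mFourierBasis, fun k => ?_⟩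
  rw [UnitAddTorus.coe_mFourierBasis]
  exact UnitAddTorus.coeFn_mFourierLp 2 k

variable {n : ℕ}

/-- The half-open cube with the opposite choice of faces. -/
def cubeIoc (n : ℕ) : Set (Fin n → ℝ) := {t | ∀ j, t j ∈ Set.Ioc (-(1 / 2) : ℝ) (-(1 / 2) + 1)}

/-- The two half-open cubes differ only in faces, which are null; the fundamental domain of the
torus uses the right-closed one. -/
theorem measurePreserving_ofLp_cube :
    MeasurePreserving (fun t : Rn n => t.ofLp) (volume.restrict (cube n))
      (volume.restrict (cubeIoc n)) := by
  have h1 : cubeIoc n =ᵐ[volume] {t : Fin n → ℝ | ∀ j, t j ∈ Set.Ico (-(1 / 2) : ℝ) (1 / 2)} := by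
    have h2 : cubeIoc n = Set.univ.pi fun _ => Set.Ioc (-(1 / 2) : ℝ) (-(1 / 2) + 1) := by
      ext t; simp [cubeIoc]
    have h3 : {t : Fin n → ℝ | ∀ j, t j ∈ Set.Ico (-(1 / 2) : ℝ) (1 / 2)} =
        Set.univ.pi fun _ => Set.Ico (-(1 / 2) : ℝ) (-(1 / 2) + 1) := by
      ext t; norm_num
    rw [h2, h3]
    exact Measure.univ_pi_Ioc_ae_eq_Icc.trans Measure.univ_pi_Ico_ae_eq_Icc.symm
  rw [Measure.restrict_congr_set h1]
  refine MeasurePreserving.restrict_preimage (s := {t : Fin n → ℝ | ∀ j, t j ∈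
    Set.Ico (-(1 / 2) : ℝ) (1 / 2)}) (PiLp.volume_preserving_ofLp (Fin n)) ?_
  have h : {t : Fin n → ℝ | ∀ j, t j ∈ Set.Ico (-(1 / 2) : ℝ) (1 / 2)} =
      ⋂ j, (fun t : Fin n → ℝ => t j) ⁻¹' Set.Ico (-(1 / 2) : ℝ) (1 / 2) := by
    ext t; simp
  rw [h]
  exact MeasurableSet.iInter fun j => measurableSet_Ico.preimage (measurable_pi_apply j)

/-- The projection of the cube to the torus. -/
def toTorus (t : Rn n) : Fin n → UnitAddCircle := fun j => (t j : UnitAddCircle)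

/-- The section of `toTorus` with values in the cube `cubeIoc`. -/
noncomputable def torusSection (x : Fin n → UnitAddCircle) : Rn n :=
  WithLp.toLp 2 (UnitAddTorus.measurableEquivPiIoc (fun _ : Fin n => (-(1 / 2) : ℝ)) x).1

theorem toTorus_eq_symm {t : Rn n} (ht : t.ofLp ∈ cubeIoc n) :
    toTorus t = (UnitAddTorus.measurableEquivPiIoc fun _ : Fin n => (-(1 / 2) : ℝ)).symm
      ⟨t.ofLp, ht⟩ := rfl

theorem measurePreserving_toTorus :
    MeasurePreserving (toTorus (n := n)) (volume.restrict (cube n)) (torusMeasure n) := by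
  have h1 := measurePreserving_pi (fun _ : Fin n => volume.restrict (Set.Ioc (-(1 / 2) : ℝ)
    (-(1 / 2) + 1))) (fun _ => (volume : Measure (AddCircle (1 : ℝ))))
    (fun _ => AddCircle.measurePreserving_mk 1 (-(1 / 2)))
  rw [← Measure.restrict_pi_pi, AddCircle.volume_eq_smul_haarAddCircle, ENNReal.ofReal_one,
    one_smul] at h1
  have h2 : cubeIoc n = Set.univ.pi fun _ => Set.Ioc (-(1 / 2) : ℝ) (-(1 / 2) + 1) := by
    ext t; simp [cubeIoc]
  rw [← h2] at h1
  exact h1.comp measurePreserving_ofLp_cube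

theorem ae_torusSection_toTorus :
    ∀ᵐ t ∂(volume.restrict (cube n)), torusSection (toTorus t) = t := by
  have h0 : MeasurableSet (cubeIoc n) := by
    have h : cubeIoc n = ⋂ j, (fun t : Fin n → ℝ => t j) ⁻¹'
        Set.Ioc (-(1 / 2) : ℝ) (-(1 / 2) + 1) := by
      ext t; simp [cubeIoc]
    rw [h]
    exact MeasurableSet.iInter fun j => measurableSet_Ioc.preimage (measurable_pi_apply j)
  filter_upwards [measurePreserving_ofLp_cube.quasiMeasurePreserving.ae (ae_restrict_mem h0)]
    with t ht
  rw [torusSection, toTorus_eq_symm ht, MeasurableEquiv.apply_symm_apply]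

theorem measurePreserving_torusSection :
    MeasurePreserving (torusSection (n := n)) (torusMeasure n) (volume.restrict (cube n)) := by
  have hm : Measurable (torusSection (n := n)) := by
    refine (PiLp.volume_preserving_toLp (Fin n)).measurable.comp ?_
    exact measurable_subtype_coe.comp (MeasurableEquiv.measurable _)
  refine ⟨hm, ?_⟩
  rw [← measurePreserving_toTorus.map_eq, Measure.map_map hm measurePreserving_toTorus.measurable]
  exact (Measure.map_congr ae_torusSection_toTorus).trans Measure.map_id

/-- The index is `-k` because `phase` carries the sign of the Fourier transform. -/
theorem mFourier_toTorus (k : Zn n) (t : Rn n) :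
    UnitAddTorus.mFourier (-k) (toTorus t) = phase (latticePt k) t := by
  change ∏ j, fourier ((-k) j) (t j : UnitAddCircle) = _
  simp only [fourier_coe_apply]
  rw [← Complex.exp_sum, phase, PiLp.inner_apply]
  congr 1
  simp only [latticePt_apply, RCLike.inner_apply, conj_trivial, Pi.neg_apply]
  push_cast
  rw [Finset.mul_sum, Finset.sum_mul]
  refine Finset.sum_congr rfl fun j _ => ?_
  ring

/-- The exponentials form a Hilbert basis of `L²` of the cube. -/
theorem exists_hilbertBasis_phase (n : ℕ) :
    ∃ b : HilbertBasis (Zn n) ℂ (Lp ℂ 2 (volume.restrict (cube n))), ∀ k,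
      b k =ᵐ[volume.restrict (cube n)] phase (latticePt k) := by
  obtain ⟨b, hb⟩ := exists_hilbertBasis_torus n
  let e := Lp.compMeasurePreservingₗᵢ (E := ℂ) (p := 2) ℂ toTorus (measurePreserving_toTorus (n := n))
  have he : Function.Surjective e := by
    intro u
    refine ⟨Lp.compMeasurePreserving torusSection measurePreserving_torusSection u, Lp.ext ?_⟩
    have h1 := Lp.coeFn_compMeasurePreserving
      (Lp.compMeasurePreserving torusSection measurePreserving_torusSection u)
      (measurePreserving_toTorus (n := n))
    have h2 := measurePreserving_toTorus.quasiMeasurePreserving.ae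
      (Lp.coeFn_compMeasurePreserving u measurePreserving_torusSection)
    filter_upwards [h1, h2, ae_torusSection_toTorus] with t h1 h2 h3
    refine h1.trans (h2.trans ?_)
    rw [Function.comp_apply, h3]
  let e' := LinearIsometryEquiv.ofSurjective e he
  let b' : HilbertBasis (Zn n) ℂ (Lp ℂ 2 (volume.restrict (cube n))) :=
    .ofRepr (e'.symm.trans b.repr)
  have hb' (k : Zn n) : b' k = e (b k) := by
    rw [← b'.repr_symm_single, ← b.repr_symm_single]
    rfl
  -- Negating the indices does not change the set of basis vectors, so density of the span carries
  -- over.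
  have hrange : Set.range (fun k => e (b (-k))) = Set.range b' := by
    rw [← (Equiv.neg (Zn n)).surjective.range_comp]
    exact congrArg Set.range (funext fun k => by simp [hb'])
  refine ⟨HilbertBasis.mk (v := fun k => e (b (-k)))
    ((b.orthonormal.comp _ neg_injective).comp_linearIsometry e)
    (by rw [hrange]; exact b'.dense_span.ge), fun k => ?_⟩
  rw [HilbertBasis.coe_mk]
  have h2 := Lp.coeFn_compMeasurePreserving (b (-k)) (measurePreserving_toTorus (n := n))
  filter_upwards [h2, measurePreserving_toTorus.quasiMeasurePreserving.ae (hb (-k))] with t h2 h3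
  rw [← mFourier_toTorus, ← h3]
  exact h2

end Exponentials

/-! ### Fibers of synthesized functions and of frame operators -/

section Synthesis

variable {n : ℕ} {s : ℝ}

theorem ae_coeFn_sum {α ι E : Type*} [MeasurableSpace α] {μ : Measure α} [NormedAddCommGroup E]
    {p : ℝ≥0∞} (S : Finset ι) (f : ι → Lp E p μ) :
    ∀ᵐ x ∂μ, (∑ j ∈ S, f j : Lp E p μ) x = ∑ j ∈ S, f j x := by
  classical
  induction S using Finset.induction_on with
  | empty =>
    filter_upwards [Lp.coeFn_zero E p μ] with x hx
    simpa using hx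
  | insert j S hj ih =>
    filter_upwards [ih, Lp.coeFn_add (f j) (∑ j ∈ S, f j)] with x h1 h2
    rw [Finset.sum_insert hj, Finset.sum_insert hj, h2, Pi.add_apply, h1]

theorem exists_seq_tendsto_finset (ι : Type*) [Countable ι] :
    ∃ S : ℕ → Finset ι, Filter.Tendsto S Filter.atTop Filter.atTop :=
  Filter.exists_seq_tendsto _

theorem HasSum.tendsto_sum_seq {ι E : Type*} [AddCommMonoid E] [TopologicalSpace E] {f : ι → E}
    {a : E} (h : HasSum f a) {S : ℕ → Finset ι} (hS : Filter.Tendsto S Filter.atTop Filter.atTop) :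
    Filter.Tendsto (fun m => ∑ j ∈ S m, f j) Filter.atTop (nhds a) := by
  rw [HasSum, SummationFilter.unconditional_filter] at h
  exact h.comp hS

/-- The fiber of a partial sum is the partial Fourier sum of `u` at `t` times the fiber of `ψ`.
Along a common subsequence both sides converge almost everywhere, so no boundedness of the fiber of
`ψ` is required. -/
theorem fiber_eq_of_hasSum {b : HilbertBasis (Zn n) ℂ (Lp ℂ 2 (volume.restrict (cube n)))}
    (hb : ∀ k, b k =ᵐ[volume.restrict (cube n)] phase (latticePt k))
    (u : Lp ℂ 2 (volume.restrict (cube n))) {ψ f : Hs n s}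
    (hf : HasSum (fun k => b.repr u k • shift k ψ) f) :
    ∀ᵐ t ∂(volume.restrict (cube n)), fiber f t = u t • fiber ψ t := by
  obtain ⟨S, hS⟩ := exists_seq_tendsto_finset (Zn n)
  obtain ⟨ns, hns, h1⟩ := exists_subseq_tendsto_fiber (HasSum.tendsto_sum_seq hf hS)
  have h2 : Filter.Tendsto (fun i => ∑ k ∈ S (ns i), b.repr u k • b k) Filter.atTop (nhds u) :=
    HasSum.tendsto_sum_seq (b.hasSum_repr u) (hS.comp hns.tendsto_atTop)
  obtain ⟨ms, hms, h3⟩ := (tendstoInMeasure_of_tendsto_Lp h2).exists_seq_tendsto_ae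
  filter_upwards [h1, h3, ae_all_iff.mpr hb,
    ae_all_iff.mpr fun i => ae_fiber_sum (S i) fun k => b.repr u k • shift k ψ,
    ae_all_iff.mpr fun k => ae_fiber_smul (b.repr u k) (shift k ψ),
    ae_all_iff.mpr fun k => ae_fiber_shift k ψ,
    ae_all_iff.mpr fun i => ae_coeFn_sum (S i) fun k => b.repr u k • b k,
    ae_all_iff.mpr fun k => Lp.coeFn_smul (b.repr u k) (b k)] with t h1 h3 h4 h5 h6 h7 h8 h9
  refine tendsto_nhds_unique (h1.comp hms.tendsto_atTop) ((h3.smul_const (fiber ψ t)).congr fun i => ?_)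
  simp only [Function.comp_apply]
  rw [h5, h8, Finset.sum_smul]
  refine Finset.sum_congr rfl fun k _ => ?_
  rw [h6, h7, h9, Pi.smul_apply, h4, smul_eq_mul, mul_smul]

theorem hasSum_sq_norm_repr (b : HilbertBasis (Zn n) ℂ (Lp ℂ 2 (volume.restrict (cube n))))
    (u : Lp ℂ 2 (volume.restrict (cube n))) :
    HasSum (fun k => ‖b.repr u k‖ ^ 2) (‖u‖ ^ 2) := by
  have h := lp.hasSum_norm (p := 2) (by norm_num) (b.repr u)
  rw [b.repr.norm_map] at h
  simpa using h

/-- If the shifts of `ψ` form a Bessel family with bound `C`, then the fibers of `ψ` are bounded. -/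
theorem IsBessel.ae_enorm_fiber_sq_le {C : ℝ} (hC : 0 ≤ C) {ψ : Hs n s}
    (h : IsBessel C fun k => shift k ψ) :
    ∀ᵐ t ∂(volume.restrict (cube n)), ‖fiber ψ t‖ₑ ^ 2 ≤ ENNReal.ofReal C := by
  obtain ⟨b, hb⟩ := exists_hilbertBasis_phase n
  refine ae_le_of_forall_setLIntegral_le_of_sigmaFinite₀ (g := fun _ => ENNReal.ofReal C)
    ((aestronglyMeasurable_fiber ψ).enorm.pow_const 2) fun E hE hE' => ?_
  -- With `u` the indicator of `E`, the synthesized `f` has the fiber of `ψ` cut off to `E`, and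
  -- Parseval turns the Bessel inequality into the integrated bound over `E`.
  set u := indicatorConstLp 2 hE hE'.ne (1 : ℂ) with hu
  have hsum := hasSum_sq_norm_repr b u
  obtain ⟨f, hf⟩ := h.summable_smul hC hsum.summable
  have h1 := h.norm_sq_le_of_hasSum hC hsum.summable hf
  rw [hsum.tsum_eq] at h1
  have h2 : ‖u‖ₑ ^ 2 = (volume.restrict (cube n)) E := by
    rw [hu, Lp.enorm_def, eLpNorm_congr_ae indicatorConstLp_coeFn,
      eLpNorm_indicator_const hE (by norm_num) (by norm_num), enorm_one, one_mul,
      ← ENNReal.rpow_natCast, ← ENNReal.rpow_mul]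
    simp
  calc ∫⁻ t in E, ‖fiber ψ t‖ₑ ^ 2 ∂(volume.restrict (cube n))
      = ∫⁻ t in cube n, ‖fiber f t‖ₑ ^ 2 := by
        rw [← lintegral_indicator hE]
        refine lintegral_congr_ae ?_
        filter_upwards [fiber_eq_of_hasSum hb u hf,
          indicatorConstLp_coeFn (p := 2) (hs := hE) (hμs := hE'.ne) (c := (1 : ℂ))] with t h3 h4
        rw [h3, hu, h4]
        by_cases ht : t ∈ E <;> simp [ht]
    _ = ‖f‖ₑ ^ 2 := lintegral_enorm_fiber_sq f
    _ = ENNReal.ofReal (‖f‖ ^ 2) := by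
        rw [ENNReal.ofReal_pow (norm_nonneg _), ofReal_norm]
    _ ≤ ENNReal.ofReal (C * ‖u‖ ^ 2) := ENNReal.ofReal_le_ofReal h1
    _ = ENNReal.ofReal C * (volume.restrict (cube n)) E := by
        rw [ENNReal.ofReal_mul hC, ENNReal.ofReal_pow (norm_nonneg _), ofReal_norm, h2]
    _ = ∫⁻ _ in E, ENNReal.ofReal C ∂(volume.restrict (cube n)) := by
        rw [setLIntegral_const]

variable {I : Type*} {B : ℝ} {φ : I → Hs n s}

/-- Product coefficients `d_k c_i` in the Bessel inequality factor its right-hand side; this reduces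
fiberwise bounds to a single generator. -/
theorem IsBessel.isBessel_shift_sum (h : IsBessel B (shifts φ)) (S : Finset I) (c : I → ℂ) :
    IsBessel (B * ∑ i ∈ S, ‖c i‖ ^ 2) fun k => shift k (∑ i ∈ S, c i • φ i) := by
  intro K d
  have h1 := h (K ×ˢ S) fun p => d p.1 * c p.2
  have h2 : ∑ p ∈ K ×ˢ S, (d p.1 * c p.2) • shifts φ p =
      ∑ k ∈ K, d k • shift k (∑ i ∈ S, c i • φ i) := by
    rw [Finset.sum_product]
    refine Finset.sum_congr rfl fun k _ => ?_
    rw [← shiftₗᵢ_apply, map_sum, Finset.smul_sum]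
    refine Finset.sum_congr rfl fun i _ => ?_
    rw [map_smul, mul_smul]
    rfl
  have h3 : ∑ p ∈ K ×ˢ S, ‖d p.1 * c p.2‖ ^ 2 =
      (∑ k ∈ K, ‖d k‖ ^ 2) * ∑ i ∈ S, ‖c i‖ ^ 2 := by
    rw [Finset.sum_product, Finset.sum_mul_sum]
    simp only [norm_mul, mul_pow]
  rw [h2, h3] at h1
  refine h1.trans_eq ?_
  ring

/-- The fibers of the generators of a Bessel family of shifts are Bessel families. -/
theorem IsBessel.ae_fiber [Countable I] (hB : 0 ≤ B) (h : IsBessel B (shifts φ)) :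
    ∀ᵐ t ∂(volume.restrict (cube n)), IsBessel B fun i => fiber (φ i) t := by
  -- A countable dense set of coefficients gives one null set; for fixed `S` the inequality is
  -- closed in `c`, so it extends to all coefficients.
  let d := TopologicalSpace.denseSeq (I → ℂ)
  have h1 : ∀ᵐ t ∂(volume.restrict (cube n)), ∀ (S : Finset I) (m : ℕ),
      ‖∑ i ∈ S, d m i • fiber (φ i) t‖ ^ 2 ≤ B * ∑ i ∈ S, ‖d m i‖ ^ 2 := by
    refine ae_all_iff.mpr fun S => ae_all_iff.mpr fun m => ?_
    have hC : 0 ≤ B * ∑ i ∈ S, ‖d m i‖ ^ 2 := by positivity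
    filter_upwards [(h.isBessel_shift_sum S (d m)).ae_enorm_fiber_sq_le hC,
      ae_fiber_sum S fun i => d m i • φ i,
      ae_all_iff.mpr fun i => ae_fiber_smul (d m i) (φ i)] with t h1 h2 h3
    rw [h2, Finset.sum_congr rfl fun i _ => h3 i, ← ofReal_norm,
      ← ENNReal.ofReal_pow (norm_nonneg _), ENNReal.ofReal_le_ofReal_iff hC] at h1
    exact h1
  filter_upwards [h1] with t ht S c
  have hc : IsClosed {c : I → ℂ |
      ‖∑ i ∈ S, c i • fiber (φ i) t‖ ^ 2 ≤ B * ∑ i ∈ S, ‖c i‖ ^ 2} :=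
    isClosed_le (by fun_prop) (by fun_prop)
  have hd : Set.range d ⊆ {c : I → ℂ |
      ‖∑ i ∈ S, c i • fiber (φ i) t‖ ^ 2 ≤ B * ∑ i ∈ S, ‖c i‖ ^ 2} := by
    rintro _ ⟨m, rfl⟩
    exact ht S m
  exact closure_minimal hd hc (TopologicalSpace.denseRange_denseSeq (I → ℂ) c)

/-- The fiber of the image under a frame operator of shifts is the image of the fiber under the
frame operator of the fibers. -/
theorem IsBessel.ae_hasSum_fiber [Countable I] (hB : 0 ≤ B) (h : IsBessel B (shifts φ))
    {f g : Hs n s} (hg : HasSum (fun p => inner ℂ (shifts φ p) f • shifts φ p) g) :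
    ∀ᵐ t ∂(volume.restrict (cube n)),
      HasSum (fun i => inner ℂ (fiber (φ i) t) (fiber f t) • fiber (φ i) t) (fiber g t) := by
  obtain ⟨b, hb⟩ := exists_hilbertBasis_phase n
  have hbessel := h.ae_fiber hB
  have hbound (i : I) : ∀ᵐ t ∂(volume.restrict (cube n)), ‖fiber (φ i) t‖ ≤ √B := by
    filter_upwards [hbessel] with t ht
    have h1 := ht {i} fun _ => 1
    simp only [Finset.sum_singleton, one_smul, norm_one, one_pow, mul_one] at h1
    exact Real.le_sqrt_of_sq_le h1
  -- Bounded generator fibers put the fiberwise inner product in `L²`, so that it has a Fourier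
  -- expansion.
  have hmem (i : I) : MemLp (fun t => inner ℂ (fiber (φ i) t) (fiber f t)) 2
      (volume.restrict (cube n)) := by
    refine (memLp_fiber f).of_le_mul (c := √B)
      ((aestronglyMeasurable_fiber (φ i)).inner (aestronglyMeasurable_fiber f)) ?_
    filter_upwards [hbound i] with t ht
    exact (norm_inner_le_norm _ _).trans (by gcongr)
  let u (i : I) := (hmem i).toLp _
  -- Its Fourier coefficients are exactly the frame coefficients of `f`, because the fiber map is
  -- isometric and turns `T_k` into a phase.
  have hrepr (i : I) (k : Zn n) : b.repr (u i) k = inner ℂ (shift k (φ i)) f := by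
    rw [b.repr_apply_apply, L2.inner_def, ← integral_inner_fiber]
    refine integral_congr_ae ?_
    filter_upwards [hb k, (hmem i).coeFn_toLp, ae_fiber_shift k (φ i)] with t h1 h2 h3
    rw [h1, h2, h3, inner_smul_left, RCLike.inner_apply, mul_comm]
  have hsum (i : I) : Summable fun k => inner ℂ (shift k (φ i)) f • shift k (φ i) :=
    hg.summable.comp_injective (i := fun k : Zn n => (k, i)) fun k l hkl => (Prod.ext_iff.mp hkl).1
  let g' (i : I) := ∑' k, inner ℂ (shift k (φ i)) f • shift k (φ i)
  have hg' : HasSum g' g := by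
    have h1 := (Equiv.prodComm I (Zn n)).hasSum_iff.mpr hg
    exact h1.prod_fiberwise fun i => (hsum i).hasSum
  have hfib (i : I) : ∀ᵐ t ∂(volume.restrict (cube n)),
      fiber (g' i) t = inner ℂ (fiber (φ i) t) (fiber f t) • fiber (φ i) t := by
    have h1 : HasSum (fun k => b.repr (u i) k • shift k (φ i)) (g' i) := by
      simp only [hrepr]
      exact (hsum i).hasSum
    filter_upwards [fiber_eq_of_hasSum hb (u i) h1, (hmem i).coeFn_toLp] with t h2 h3
    rw [h2, h3]
  obtain ⟨S, hS⟩ := exists_seq_tendsto_finset I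
  obtain ⟨ns, hns, hlim⟩ := exists_subseq_tendsto_fiber (HasSum.tendsto_sum_seq hg' hS)
  filter_upwards [hlim, hbessel, ae_all_iff.mpr hfib,
    ae_all_iff.mpr fun i => ae_fiber_sum (S i) g'] with t h1 h2 h3 h4
  -- The fiberwise series converges unconditionally by the Bessel bound; the subsequence only has to
  -- identify its sum.
  have h5 := (h2.summable_smul hB (h2.summable_inner hB (fiber f t))).hasSum
  convert h5 using 1
  refine tendsto_nhds_unique h1 ((HasSum.tendsto_sum_seq h5 (hS.comp hns.tendsto_atTop)).congr fun i => ?_)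
  simp only [Function.comp_apply]
  rw [h4]
  exact Finset.sum_congr rfl fun i _ => (h3 i).symm

/-- Clear on the span, since shifts only rescale fibers; limits pass through an almost everywhere
convergent subsequence because `J(t)` is closed. -/
theorem ae_fiber_mem_rangeFunction [Countable I] {f : Hs n s} (hf : f ∈ shiftSpan φ) :
    ∀ᵐ t ∂(volume.restrict (cube n)), fiber f t ∈ rangeFunction φ t := by
  have hspan (g : Hs n s) (hg : g ∈ Submodule.span ℂ (Set.range (shifts φ))) :
      ∀ᵐ t ∂(volume.restrict (cube n)), fiber g t ∈ rangeFunction φ t := by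
    induction hg using Submodule.span_induction with
    | mem g hg =>
      obtain ⟨⟨k, i⟩, rfl⟩ := hg
      filter_upwards [ae_fiber_shift k (φ i)] with t ht
      exact ht ▸ Submodule.smul_mem _ _ (fiber_mem_rangeFunction φ i t)
    | zero =>
      filter_upwards [ae_fiber_sum (∅ : Finset ℕ) fun _ => (0 : Hs n s)] with t ht
      exact ht ▸ zero_mem _
    | add g h _ _ hg hh =>
      filter_upwards [ae_fiber_add g h, hg, hh] with t ht h1 h2
      exact ht ▸ add_mem h1 h2
    | smul c g _ hg =>
      filter_upwards [ae_fiber_smul c g, hg] with t ht h1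
      exact ht ▸ Submodule.smul_mem _ _ h1
  obtain ⟨u, hu, hlim⟩ := mem_closure_iff_seq_limit.mp hf
  obtain ⟨ns, _, h⟩ := exists_subseq_tendsto_fiber hlim
  filter_upwards [h, ae_all_iff.mpr fun m => hspan (u m) (hu m)] with t h1 h2
  exact (Submodule.isClosed_topologicalClosure _).mem_of_tendsto h1 (.of_forall fun i => h2 (ns i))

end Synthesis

/-! ### The range operator of the frame operator -/

section RangeOperators

variable {n : ℕ} {s : ℝ} {I : Type*} {φ : I → Hs n s}

open Classical in
/-- The fiberwise frame operator, set to `0` at the points where it is not defined. -/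
noncomputable def fiberFrameOperator (φ : I → Hs n s) (t : Rn n) : Ell2 n s →L[ℂ] Ell2 n s :=
  if h : ∃ G : Ell2 n s →L[ℂ] Ell2 n s,
    ∀ a, HasSum (fun i => inner ℂ (fiber (φ i) t) a • fiber (φ i) t) (G a) then h.choose else 0

theorem IsBessel.hasSum_fiberFrameOperator {B : ℝ} (hB : 0 ≤ B) {t : Rn n}
    (h : IsBessel B fun i => fiber (φ i) t) (a : Ell2 n s) :
    HasSum (fun i => inner ℂ (fiber (φ i) t) a • fiber (φ i) t) (fiberFrameOperator φ t a) := by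
  have h1 := h.exists_frameOperator hB
  rw [fiberFrameOperator, dif_pos h1]
  exact h1.choose_spec a

/-- Operators on `J(t)` are determined by the generators. As these are countably many in the
application, operator identities then hold outside one null set. -/
theorem clm_rangeFunction_ext {t : Rn n} {E : Type*} [NormedAddCommGroup E]
    [NormedSpace ℂ E] {G G' : rangeFunction φ t →L[ℂ] E}
    (h : ∀ i, G ⟨fiber (φ i) t, fiber_mem_rangeFunction φ i t⟩ =
      G' ⟨fiber (φ i) t, fiber_mem_rangeFunction φ i t⟩) : G = G' := by
  let K := LinearMap.eqLocus (G : rangeFunction φ t →ₗ[ℂ] E) (G' : rangeFunction φ t →ₗ[ℂ] E)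
  have hK : IsClosed (K : Set (rangeFunction φ t)) := isClosed_eq G.continuous G'.continuous
  have hJ : IsClosed (rangeFunction φ t : Set (Ell2 n s)) := Submodule.isClosed_topologicalClosure _
  have hle : rangeFunction φ t ≤ K.map (rangeFunction φ t).subtype := by
    refine Submodule.topologicalClosure_minimal _ (Submodule.span_le.mpr ?_)
      (hJ.isClosedEmbedding_subtypeVal.isClosedMap _ hK)
    rintro _ ⟨i, rfl⟩
    exact ⟨⟨fiber (φ i) t, fiber_mem_rangeFunction φ i t⟩, h i, rfl⟩
  ext a
  obtain ⟨a', ha', haa'⟩ := hle a.2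
  rw [← Subtype.ext haa']
  exact ha'

theorem IsBessel.fiberFrameOperator_mem {B : ℝ} (hB : 0 ≤ B) {t : Rn n} {J : Submodule ℂ (Ell2 n s)}
    (hJ : IsClosed (J : Set (Ell2 n s))) (hφ : ∀ i, fiber (φ i) t ∈ J)
    (h : IsBessel B fun i => fiber (φ i) t) (a : Ell2 n s) : fiberFrameOperator φ t a ∈ J := by
  have h1 := h.hasSum_fiberFrameOperator hB a
  rw [HasSum, SummationFilter.unconditional_filter] at h1
  exact hJ.mem_of_tendsto h1 (.of_forall fun S =>
    Submodule.sum_mem _ fun i _ => Submodule.smul_mem _ _ (hφ i))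

variable [Countable I] {B : ℝ}

/-- The range operator given by the fiberwise frame operator. -/
noncomputable def frameRangeOperator (φ : I → Hs n s) : RangeOperator (rangeFunction φ) :=
  fun t => fiberFrameOperator φ t ∘L (rangeFunction φ t).subtypeL

/-- The matrix coefficient is a countable sum of products of measurable inner products; the
projection disappears because the generator fibers lie in `J(t)`. -/
theorem isMeasurable_frameRangeOperator (hB : 0 ≤ B) (h : IsBessel B (shifts φ)) :
    (frameRangeOperator φ).IsMeasurable := by
  intro a b
  refine aemeasurable_of_tendsto_metrizable_ae (Filter.atTop : Filter (Finset I))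
    (f := fun S t => ∑ i ∈ S, inner ℂ (fiber (φ i) t) a * inner ℂ b (fiber (φ i) t))
    (fun S => ?_) ?_
  · refine Finset.aemeasurable_fun_sum S fun i _ => ?_
    exact (((aestronglyMeasurable_fiber (φ i)).inner aestronglyMeasurable_const).mul
      (aestronglyMeasurable_const.inner (aestronglyMeasurable_fiber (φ i)))).aemeasurable
  · filter_upwards [h.ae_fiber hB] with t ht
    have h1 := (innerSL ℂ b).hasSum (ht.hasSum_fiberFrameOperator hB
      ((rangeFunction φ t).orthogonalProjectionOnto a : Ell2 n s))
    rw [HasSum, SummationFilter.unconditional_filter] at h1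
    refine h1.congr fun S => Finset.sum_congr rfl fun i _ => ?_
    rw [map_smul, smul_eq_mul, innerSL_apply_apply]
    congr 1
    exact Submodule.inner_orthogonalProjectionOnto_eq_of_mem_left
      ⟨fiber (φ i) t, fiber_mem_rangeFunction φ i t⟩ a

variable {F : shiftSpan φ →L[ℂ] shiftSpan φ}

theorem IsFrameOperator.ae_fiber (hB : 0 ≤ B) (h : IsBessel B (shifts φ))
    (hF : IsFrameOperator (shiftSpan φ) (shifts φ) F) (f : shiftSpan φ) :
    ∀ᵐ t ∂(volume.restrict (cube n)),
      fiber (F f : Hs n s) t = fiberFrameOperator φ t (fiber (f : Hs n s) t) := by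
  filter_upwards [h.ae_fiber hB, h.ae_hasSum_fiber hB (hF f)] with t h1 h2
  exact h2.unique (h1.hasSum_fiberFrameOperator hB _)

theorem IsFrameOperator.represents (hB : 0 ≤ B) (h : IsBessel B (shifts φ))
    (hF : IsFrameOperator (shiftSpan φ) (shifts φ) F) :
    (frameRangeOperator φ).Represents ((shiftSpan φ).subtypeL ∘L F) := by
  intro f
  filter_upwards [ae_fiber_mem_rangeFunction f.2, hF.ae_fiber hB h f] with t h1 h2
  exact ⟨h1, h2⟩

theorem ContinuousLinearEquiv.exists_of_eqOn {E : Type*} [NormedAddCommGroup E] [NormedSpace ℂ E]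
    {J : Submodule ℂ E} {G Q : E →L[ℂ] E} (hG : ∀ a ∈ J, G a ∈ J) (hQ : ∀ a ∈ J, Q a ∈ J)
    (hQG : ∀ a ∈ J, Q (G a) = a) (hGQ : ∀ a ∈ J, G (Q a) = a) :
    ∃ e : J ≃L[ℂ] J, (∀ a : J, (e a : E) = G a) ∧ ∀ a : J, (e.symm a : E) = Q a :=
  ⟨ContinuousLinearEquiv.equivOfInverse
    ((G ∘L J.subtypeL).codRestrict J fun a => hG a a.2)
    ((Q ∘L J.subtypeL).codRestrict J fun a => hQ a a.2)
    (fun a => Subtype.ext (hQG a a.2)) (fun a => Subtype.ext (hGQ a a.2)),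
    fun _ => rfl, fun _ => rfl⟩

/-- If two frame operators of shifts are inverse to each other, then every range operator of the
first one is almost everywhere invertible. -/
theorem RangeOperator.Represents.ae_exists_equiv {C : ℝ} {θ : I → Hs n s}
    {F : shiftSpan φ ≃L[ℂ] shiftSpan φ} (hB : 0 ≤ B) (hC : 0 ≤ C) (hφ : IsBessel B (shifts φ))
    (hθ : IsBessel C (shifts θ)) (hθF : ∀ i, θ i = F.symm ⟨φ i, mem_shiftSpan φ i⟩)
    (hF : IsFrameOperator (shiftSpan φ) (shifts φ) (F : shiftSpan φ →L[ℂ] shiftSpan φ))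
    (hF' : IsFrameOperator (shiftSpan φ) (shifts θ) (F.symm : shiftSpan φ →L[ℂ] shiftSpan φ))
    {R : RangeOperator (rangeFunction φ)}
    (hR : R.Represents ((shiftSpan φ).subtypeL ∘L (F : shiftSpan φ →L[ℂ] shiftSpan φ))) :
    ∀ᵐ t ∂(volume.restrict (cube n)), ∃ e : rangeFunction φ t ≃L[ℂ] rangeFunction φ t,
      (∀ a, (e a : Ell2 n s) = R t a) ∧
      ∀ i, fiber (θ i) t = e.symm ⟨fiber (φ i) t, fiber_mem_rangeFunction φ i t⟩ := by
  let f (i : I) : shiftSpan φ := ⟨φ i, mem_shiftSpan φ i⟩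
  have hQ (g : shiftSpan φ) : ∀ᵐ t ∂(volume.restrict (cube n)),
      fiber (F.symm g : Hs n s) t = fiberFrameOperator θ t (fiber (g : Hs n s) t) := by
    filter_upwards [hθ.ae_fiber hC, hθ.ae_hasSum_fiber hC (hF' g)] with t h1 h2
    exact h2.unique (h1.hasSum_fiberFrameOperator hC _)
  filter_upwards [hφ.ae_fiber hB, hθ.ae_fiber hC,
    ae_all_iff.mpr fun i => ae_fiber_mem_rangeFunction (F.symm (f i)).2,
    ae_all_iff.mpr fun i => hR (f i),
    ae_all_iff.mpr fun i => hF.ae_fiber hB hφ (f i),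
    ae_all_iff.mpr fun i => hQ (f i),
    ae_all_iff.mpr fun i => hQ (F (f i)),
    ae_all_iff.mpr fun i => hF.ae_fiber hB hφ (F.symm (f i))] with t hφt hθt h1 h2 h3 h4 h5 h6
  simp only [F.symm_apply_apply] at h5
  simp only [ContinuousLinearEquiv.coe_coe, F.apply_symm_apply] at h3 h6
  have hJ : IsClosed (rangeFunction φ t : Set (Ell2 n s)) := Submodule.isClosed_topologicalClosure _
  -- Any representing `R` agrees with the fiberwise frame operator on the generators, so it is
  -- determined almost everywhere.
  have hRG : R t = fiberFrameOperator φ t ∘L (rangeFunction φ t).subtypeL := by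
    refine clm_rangeFunction_ext fun i => ?_
    obtain ⟨_, h7⟩ := h2 i
    exact h7.symm.trans (h3 i)
  -- `F⁻¹ F φ_i = φ_i` read in the fibers; the other order uses `F F⁻¹ φ_i = φ_i`.
  have hQG : (fiberFrameOperator θ t ∘L fiberFrameOperator φ t) ∘L (rangeFunction φ t).subtypeL =
      (rangeFunction φ t).subtypeL := by
    refine clm_rangeFunction_ext fun i => ?_
    change fiberFrameOperator θ t (fiberFrameOperator φ t (fiber (f i : Hs n s) t)) = _
    rw [← h3, ← h5]
    rfl
  have hGQ : (fiberFrameOperator φ t ∘L fiberFrameOperator θ t) ∘L (rangeFunction φ t).subtypeL =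
      (rangeFunction φ t).subtypeL := by
    refine clm_rangeFunction_ext fun i => ?_
    change fiberFrameOperator φ t (fiberFrameOperator θ t (fiber (f i : Hs n s) t)) = _
    rw [← h4, ← h6]
    rfl
  obtain ⟨e, he, he'⟩ := ContinuousLinearEquiv.exists_of_eqOn (J := rangeFunction φ t)
    (fun a _ => hφt.fiberFrameOperator_mem hB hJ (fun i => fiber_mem_rangeFunction φ i t) a)
    (fun a _ => hθt.fiberFrameOperator_mem hC hJ (fun i => by rw [hθF]; exact h1 i) a)
    (fun a ha => DFunLike.congr_fun hQG ⟨a, ha⟩) (fun a ha => DFunLike.congr_fun hGQ ⟨a, ha⟩)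
  refine ⟨e, fun a => ?_, fun i => ?_⟩
  · rw [he, hRG]
    rfl
  · rw [he', hθF]
    exact h4 i

end RangeOperators

/-! ### The space generated by the canonical dual -/

section CanonicalDual

variable {n : ℕ} {s : ℝ} {I : Type*} {φ θ : I → Hs n s}

theorem mem_of_hasSum_smul {H ι : Type*} [NormedAddCommGroup H] [NormedSpace ℂ H]
    {V : Submodule ℂ H} (hV : IsClosed (V : Set H)) {e : ι → H} (he : ∀ j, e j ∈ V) {c : ι → ℂ}
    {f : H} (hf : HasSum (fun j => c j • e j) f) : f ∈ V := by
  rw [HasSum, SummationFilter.unconditional_filter] at hf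
  exact hV.mem_of_tendsto hf (.of_forall fun S =>
    Submodule.sum_mem _ fun j _ => Submodule.smul_mem _ _ (he j))

/-- The nontrivial inclusion comes from the second dual expansion, which writes each `f` as a series
in the shifts of the `θ_i`. -/
theorem shiftSpan_eq_of_isDualOn (hθ : ∀ p, shifts θ p ∈ shiftSpan φ)
    (h : IsDualOn (shiftSpan φ) (shifts φ) (shifts θ)) : shiftSpan θ = shiftSpan φ := by
  refine le_antisymm (Submodule.topologicalClosure_minimal _ (Submodule.span_le.mpr ?_)
    (Submodule.isClosed_topologicalClosure _)) fun f hf => ?_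
  · rintro _ ⟨p, rfl⟩
    exact hθ p
  · exact mem_of_hasSum_smul (Submodule.isClosed_topologicalClosure _)
      (shifts_mem_shiftSpan θ) (h f hf).2

end CanonicalDual

end SobolevSI

theorem mainTheorem3 {n : ℕ} (hn : 0 < n) (s : ℝ) {I : Type*} [Countable I] (φ : I → Hs n s)
    (A B : ℝ)
    (h : IsFrame A B (shiftSpan φ) (shifts φ) ∨ IsRieszFamily A B (shifts φ)) :
    ∃ F : shiftSpan φ ≃L[ℂ] shiftSpan φ, ∃ θ : I → Hs n s,
      -- `F` is the frame operator, and `θ_i = F⁻¹ φ_i`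
      IsFrameOperator (shiftSpan φ) (shifts φ) (F : shiftSpan φ →L[ℂ] shiftSpan φ) ∧
      (∀ i, θ i = F.symm ⟨φ i, mem_shiftSpan φ i⟩) ∧
      -- `F` and `F⁻¹` are shift-preserving
      IsShiftPreserving (shiftSpan φ)
        ((shiftSpan φ).subtypeL ∘L (F : shiftSpan φ →L[ℂ] shiftSpan φ)) ∧
      IsShiftPreserving (shiftSpan φ)
        ((shiftSpan φ).subtypeL ∘L (F.symm : shiftSpan φ →L[ℂ] shiftSpan φ)) ∧
      -- the shifts of the `θ_i` are the dual frame, of the same space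
      shiftSpan θ = shiftSpan φ ∧
      (∀ (k : Zn n) (i : I), ∃ hk : shift k (φ i) ∈ shiftSpan φ,
        shift k (θ i) = F.symm ⟨shift k (φ i), hk⟩) ∧
      IsFrame B⁻¹ A⁻¹ (shiftSpan φ) (shifts θ) ∧
      IsDualOn (shiftSpan φ) (shifts φ) (shifts θ) ∧
      -- in the Riesz case they are the dual Riesz family
      (IsRieszFamily A B (shifts φ) →
        IsRieszFamily B⁻¹ A⁻¹ (shifts θ) ∧ IsBiorthogonal (shifts φ) (shifts θ)) ∧
      -- the range operator `R` of `F` exists and is invertible a.e., and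
      -- `𝒯_s θ_i (t) = R(t)⁻¹ (𝒯_s φ_i (t))`
      (∃ R : RangeOperator (rangeFunction φ), R.IsMeasurable ∧
        R.Represents ((shiftSpan φ).subtypeL ∘L (F : shiftSpan φ →L[ℂ] shiftSpan φ))) ∧
      ∀ R : RangeOperator (rangeFunction φ),
        R.Represents ((shiftSpan φ).subtypeL ∘L (F : shiftSpan φ →L[ℂ] shiftSpan φ)) →
        ∀ᵐ t ∂(volume.restrict (cube n)),
          ∃ e : rangeFunction φ t ≃L[ℂ] rangeFunction φ t,
            (∀ a, (e a : Ell2 n s) = R t a) ∧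
            ∀ i, fiber (θ i) t = e.symm ⟨fiber (φ i) t, fiber_mem_rangeFunction φ i t⟩ := by
  have hframe : IsFrame A B (shiftSpan φ) (shifts φ) := h.elim id fun h => h.isFrame
  have hA := hframe.pos
  have hB := hframe.bound_pos
  obtain ⟨F, hF⟩ := hframe.exists_frameOperator
  let θ (i : I) : Hs n s := F.symm ⟨φ i, mem_shiftSpan φ i⟩
  have hθ (k : Zn n) (i : I) : shift k (θ i) =
      F.symm ⟨shift k (φ i), shifts_mem_shiftSpan φ (k, i)⟩ :=
    (congrArg Subtype.val (hF.symm_map_shift k ⟨φ i, mem_shiftSpan φ i⟩)).symm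
  -- Since `F⁻¹` commutes with shifts, the shifts of `θ` are the canonical dual of the whole family,
  -- so the abstract duality results apply.
  have hshifts : shifts θ = fun p => (F.symm ⟨shifts φ p, hframe.mem p⟩ : Hs n s) :=
    funext fun p => hθ p.1 p.2
  have hdual : IsDualOn (shiftSpan φ) (shifts φ) (shifts θ) := by
    rw [hshifts]
    exact hF.isDualOn hframe.mem
  have hframe' : IsFrame B⁻¹ A⁻¹ (shiftSpan φ) (shifts θ) := by
    rw [hshifts]
    exact hframe.dual hF
  -- This makes `F⁻¹` a frame operator of shifts too, so its action on fibers is known in the same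
  -- way as that of `F`.
  have hF' : IsFrameOperator (shiftSpan φ) (shifts θ) (F.symm : shiftSpan φ →L[ℂ] shiftSpan φ) := by
    rw [hshifts]
    exact hF.dual hframe.mem
  refine ⟨F, θ, hF, fun i => rfl, ⟨isShiftInvariant_shiftSpan φ, fun k f => ?_⟩,
    ⟨isShiftInvariant_shiftSpan φ, fun k f => ?_⟩, shiftSpan_eq_of_isDualOn hframe'.mem hdual,
    fun k i => ⟨_, hθ k i⟩, hframe', hdual, fun hR => ?_,
    ⟨frameRangeOperator φ, isMeasurable_frameRangeOperator hB.le hframe.isBessel,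
      hF.represents hB.le hframe.isBessel⟩, fun R hR => ?_⟩
  · exact congrArg Subtype.val (hF.map_shift k f)
  · exact congrArg Subtype.val (hF.symm_map_shift k f)
  · have hb := hR.isBiorthogonal hframe.mem hdual
    exact ⟨hb.isRieszFamily hA hframe.le hR.isBessel hframe'.isBessel, hb⟩
  · exact hR.ae_exists_equiv hB.le (inv_nonneg.mpr hA.le) hframe.isBessel hframe'.isBessel
      (fun i => rfl) hF hF'
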